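/- Let $d\ge 2$ and $R>0$. Let $A\subset\mathbb R^d$ be a compact convex set with $0\in A$, let $\varphi:A\to[0,R]$ be a continuous function with convex sublevel sets $A_r=\{x\in A:\varphi(x)\le r\}$ and $\varphi(0)=0$, let $\rho_0\ge 0$ be a probability density on $A$ that is differentiable in the interior of $A$, and let $\rho_1$ be a function on $B_R=\{|y|\le R\}$, positive on $B_R\setminus\{0\}$. For $0<r\le R$ and $\theta\in S^{d-1}$ put $$H(r,\theta)=\sup_{x\in A_r}\langle\theta,x\rangle,\qquad T^{-1}(r\theta)=H\,\theta+D_\theta H,\qquad P(r,\theta)=\rho_1(r\theta)\,r^{d-1},$$ where $D_\theta$ and $D^2_\theta$ are the gradient and the Hessian on $S^{d-1}$. Assume that $H$ is of class $C^2$ in $\theta$ and differentiable in $r$, that $H_r$, $D_\theta H$, $D^2_\theta H$ are continuous and continuously differentiable in $r$ on $(0,R]\times S^{d-1}$ (jointly continuous, one-sided derivatives at $r=R$), and that $H$ solves the change of variables equation $$P=\rho_0(T^{-1})\,H_r\,\det\bigl(H\cdot\mathrm{Id}+D^2_\theta H\bigr)\quad\text{on }(0,R]\times S^{d-1}.$$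 Assume that $\partial A$ is of class $C^2$ (in particular, $\partial A$ may be smooth), and let $K$ be its Gauss curvature. Below, $\nabla\varphi$ is the gradient of $\varphi$ on $A$ (one-sided at points of $\partial A$). (a) Let $C,\lambda_0>0$. Suppose that $|\nabla\rho_0|\le C\rho_0^{1+1/d}$ in the interior of $A$, $P\le C$ on $(0,R]\times S^{d-1}$, $K\ge\lambda_0$ and $\rho_0\le C$ on $\partial A$, $P(R,\cdot)\ge 1/C$, and that $u:(0,R]\to\mathbb R$ satisfies $u\in L^1([a,R])$ for every $0<a<R$ and $P_r/P\le u(r)$ for $0<r<R$. Then for all $r\in(0,R]$ and $\theta\in S^{d-1}$ $$H_r(r,\theta)\ge D_1\exp\Bigl(-\int_r^R u(s)\,ds\Bigr),$$ and $\varphi$ is differentiable at every $x\in A$ with $\varphi(x)>0$, with $$|\nabla\varphi(x)|\le D_2\exp\Bigl(\int_{\varphi(x)}^R u(s)\,ds\Bigr),$$ where $D_1,D_2>0$ depend only on $d,C,\lambda_0,R$. (b) Let $C,\varepsilon>0$ and $\Lambda_0\in\mathbb R$. Suppose that $|\nabla\rho_0|/\rho_0\le C$ in the interior of $A$, $\rho_0\ge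 1/C$ on $A$, $P\le C$ on $(0,R]\times S^{d-1}$, $P_r/P\ge -C$ for $0<r<R$, $K\le\Lambda_0$ on $\partial A$, and $H(r,\theta)\ge\varepsilon r$ for all $r\in(0,R]$, $\theta\in S^{d-1}$. Then for all $r\in(0,R]$ and $\theta\in S^{d-1}$ $$H_r(r,\theta)\le\frac{D_1}{r^d},$$ and $\varphi$ is differentiable at every $x\in A$ with $\varphi(x)>0$, with $$|\nabla\varphi(x)|\ge D_2\,\varphi(x)^d,$$ where $D_1,D_2>0$ depend only on $d,C,R,\varepsilon,\Lambda_0$. -/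

import Mathlib

open Set Filter Topology MeasureTheory

noncomputable section

namespace GaussTransport

variable {d : ℕ}

/-! ### Calculus on the unit sphere of `ℝ^d` -/

/-- The compression `v ↦ π (L v)` of an endomorphism `L` of `ℝ^d` to the hyperplane orthogonal
to `n`, where `π` is the orthogonal projection onto that hyperplane. -/
def compress (L : EuclideanSpace ℝ (Fin d) →L[ℝ] EuclideanSpace ℝ (Fin d))
    (n : EuclideanSpace ℝ (Fin d)) : (ℝ ∙ n)ᗮ →L[ℝ] (ℝ ∙ n)ᗮ :=
  ((ℝ ∙ n)ᗮ).orthogonalProjectionOnto ∘L L ∘L ((ℝ ∙ n)ᗮ).subtypeL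

/-- The extension, constant along rays, of a function on the unit sphere. -/
def radialExt (f : EuclideanSpace ℝ (Fin d) → ℝ) (x : EuclideanSpace ℝ (Fin d)) : ℝ :=
  f (‖x‖⁻¹ • x)

/-- The gradient `D_θ f` on the unit sphere at a unit vector `θ`: the Euclidean gradient at `θ` of
the extension of `f` that is constant along rays (it is automatically tangent to the sphere). -/
def sphGrad (f : EuclideanSpace ℝ (Fin d) → ℝ) (θ : EuclideanSpace ℝ (Fin d)) :
    EuclideanSpace ℝ (Fin d) :=
  gradient (radialExt f) θ

/-- The Hessian `D²_θ f` on the unit sphere at a unit vector `θ`, an endomorphism of the tangent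
space `θ^⊥`: the restriction to `θ^⊥` of the Euclidean Hessian at `θ` of the extension of `f` that
is constant along rays. (Along a great circle `γ` with `γ 0 = θ`, the acceleration `-θ` is
annihilated by the differential of that extension, so this is the Riemannian Hessian.) -/
def sphHess (f : EuclideanSpace ℝ (Fin d) → ℝ) (θ : EuclideanSpace ℝ (Fin d)) :
    (ℝ ∙ θ)ᗮ →L[ℝ] (ℝ ∙ θ)ᗮ :=
  compress (fderiv ℝ (gradient (radialExt f)) θ) θ

/-- The spherical Hessian, extended by zero in the normal direction `θ` to an endomorphism of
`ℝ^d`, so that its values at different points can be compared. -/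
def sphHessExt (f : EuclideanSpace ℝ (Fin d) → ℝ) (θ : EuclideanSpace ℝ (Fin d)) :
    EuclideanSpace ℝ (Fin d) →L[ℝ] EuclideanSpace ℝ (Fin d) :=
  ((ℝ ∙ θ)ᗮ).subtypeL ∘L sphHess f θ ∘L ((ℝ ∙ θ)ᗮ).orthogonalProjectionOnto

/-! ### The Gauss curvature of the boundary of a set -/

/-- `ψ` is a `C²` defining function of the set `A` near its boundary point `x`. -/
structure IsDefiningFunctionAt (A : Set (EuclideanSpace ℝ (Fin d)))
    (x : EuclideanSpace ℝ (Fin d)) (ψ : EuclideanSpace ℝ (Fin d) → ℝ) : Prop where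
  contDiffAt : ContDiffAt ℝ 2 ψ x
  eq_zero : ψ x = 0
  gradient_ne_zero : gradient ψ x ≠ 0
  mem_iff : ∀ᶠ y in 𝓝 x, y ∈ A ↔ ψ y ≤ 0

/-- The boundary of `A` is a hypersurface of class `C²` (and `A` lies locally on one side). -/
def HasC2Boundary (A : Set (EuclideanSpace ℝ (Fin d))) : Prop :=
  ∀ x ∈ frontier A, ∃ ψ, IsDefiningFunctionAt A x ψ

/-- The Gauss curvature at `x` of the level set of `ψ` through `x`, with respect to the normal
`∇ψ / |∇ψ|`: the determinant of the differential of the normal field, that is, of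
`|∇ψ|⁻¹ D²ψ` on the tangent space. It is positive for round spheres with outer normal. -/
def levelSetCurvature (ψ : EuclideanSpace ℝ (Fin d) → ℝ) (x : EuclideanSpace ℝ (Fin d)) : ℝ :=
  (compress (‖gradient ψ x‖⁻¹ • fderiv ℝ (gradient ψ) x) (gradient ψ x)).det

open Classical in
/-- The Gauss curvature `K(x)` of the boundary of `A` at the boundary point `x`, with respect to
the outer normal (it does not depend on the defining function). -/
def gaussCurvature (A : Set (EuclideanSpace ℝ (Fin d))) (x : EuclideanSpace ℝ (Fin d)) : ℝ :=
  if h : ∃ ψ, IsDefiningFunctionAt A x ψ then levelSetCurvature h.choose x else 0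

/-! ### The potential `φ`, its dual potential `H`, and the change of variables equation -/

/-- The dual potential `H(r, θ) = sup { ⟨θ, x⟩ : x ∈ A, φ(x) ≤ r }`, i.e. the support function of
the sublevel set `A_r` of `φ`. -/
def dualPotential (A : Set (EuclideanSpace ℝ (Fin d))) (φ : EuclideanSpace ℝ (Fin d) → ℝ)
    (r : ℝ) (θ : EuclideanSpace ℝ (Fin d)) : ℝ :=
  sSup ((fun x => inner ℝ θ x) '' {x | x ∈ A ∧ φ x ≤ r})

/-- The derivative in `r ∈ (0, R]` of a family depending on `(r, θ)` (one-sided at `r = R`). -/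
def radialDeriv {V : Type*} [NormedAddCommGroup V] [NormedSpace ℝ V] (R : ℝ)
    (G : ℝ → EuclideanSpace ℝ (Fin d) → V) (r : ℝ) (θ : EuclideanSpace ℝ (Fin d)) : V :=
  derivWithin (fun s => G s θ) (Ioc 0 R) r

/-- `G` is continuous on `(0, R] × S^{d-1}` and continuously differentiable in `r` there, up to
`r = R`, with `G_r` continuous in `(r, θ)`. -/
structure IsC1InRadius {V : Type*} [NormedAddCommGroup V] [NormedSpace ℝ V] (R : ℝ)
    (G : ℝ → EuclideanSpace ℝ (Fin d) → V) : Prop where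
  continuousOn : ContinuousOn (fun p : ℝ × EuclideanSpace ℝ (Fin d) => G p.1 p.2)
    (Ioc 0 R ×ˢ Metric.sphere 0 1)
  differentiableOn : ∀ θ ∈ Metric.sphere (0 : EuclideanSpace ℝ (Fin d)) 1,
    DifferentiableOn ℝ (fun s => G s θ) (Ioc 0 R)
  continuousOn_radialDeriv :
    ContinuousOn (fun p : ℝ × EuclideanSpace ℝ (Fin d) => radialDeriv R G p.1 p.2)
      (Ioc 0 R ×ˢ Metric.sphere 0 1)

/-- The smoothness required of `H`: `H` is `C²` in `θ`, differentiable in `r`, and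
`H_r`, `H_θ`, `H_θθ` are continuous and continuously differentiable in `r`, away from the origin
and up to `r = R`. -/
structure IsSmoothPotential (R : ℝ) (H : ℝ → EuclideanSpace ℝ (Fin d) → ℝ) : Prop where
  contDiffOn : ∀ r ∈ Ioc 0 R, ContDiffOn ℝ 2 (radialExt (H r)) {0}ᶜ
  c1 : IsC1InRadius R H
  c1_radialDeriv : IsC1InRadius R (radialDeriv R H)
  c1_sphGrad : IsC1InRadius R (fun r => sphGrad (H r))
  c1_sphHess : IsC1InRadius R (fun r => sphHessExt (H r))

/-- The inverse transport map in polar coordinates, `T⁻¹(rθ) = H θ + D_θ H`. -/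
def inverseTransport (H : ℝ → EuclideanSpace ℝ (Fin d) → ℝ) (r : ℝ)
    (θ : EuclideanSpace ℝ (Fin d)) : EuclideanSpace ℝ (Fin d) :=
  H r θ • θ + sphGrad (H r) θ

/-- `det (H Id + D²_θ H)` at `(r, θ)`, a determinant on the tangent space of the sphere. -/
def curvatureDet (H : ℝ → EuclideanSpace ℝ (Fin d) → ℝ) (r : ℝ)
    (θ : EuclideanSpace ℝ (Fin d)) : ℝ :=
  (H r θ • ContinuousLinearMap.id ℝ ((ℝ ∙ θ)ᗮ : Submodule ℝ (EuclideanSpace ℝ (Fin d)))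
    + sphHess (H r) θ).det

/-- The density `P = ρ₁ r^{d-1}` of the target measure in polar coordinates. -/
def polarDensity (ρ₁ : EuclideanSpace ℝ (Fin d) → ℝ) (r : ℝ)
    (θ : EuclideanSpace ℝ (Fin d)) : ℝ :=
  ρ₁ (r • θ) * r ^ (d - 1)

/-- The change of variables equation `P = ρ₀(T⁻¹) H_r det (H Id + D²_θ H)` on `B_R ∖ {0}`. -/
def SolvesChangeOfVariables (R : ℝ) (H : ℝ → EuclideanSpace ℝ (Fin d) → ℝ)
    (ρ₀ ρ₁ : EuclideanSpace ℝ (Fin d) → ℝ) : Prop :=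
  ∀ r ∈ Ioc 0 R, ∀ θ ∈ Metric.sphere (0 : EuclideanSpace ℝ (Fin d)) 1,
    polarDensity ρ₁ r θ =
      ρ₀ (inverseTransport H r θ) * radialDeriv R H r θ * curvatureDet H r θ

/-- Standing assumptions on the data: `A` is a compact convex set, `φ : A → [0, R]` is a continuous
function with convex sublevel sets, normalized by `φ(0) = 0` (so that `H ≥ 0`), `ρ₀` is a
probability density on `A`, differentiable in the interior, and `ρ₁` is positive on
`B_R ∖ {0}`. -/
structure IsGaussData (R : ℝ) (A : Set (EuclideanSpace ℝ (Fin d)))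
    (φ ρ₀ ρ₁ : EuclideanSpace ℝ (Fin d) → ℝ) : Prop where
  isCompact : IsCompact A
  convex : Convex ℝ A
  continuousOn : ContinuousOn φ A
  mapsTo : MapsTo φ A (Icc 0 R)
  convex_sublevel : ∀ r, Convex ℝ {x | x ∈ A ∧ φ x ≤ r}
  zero_mem : (0 : EuclideanSpace ℝ (Fin d)) ∈ A
  map_zero : φ 0 = 0
  source_nonneg : ∀ x ∈ A, 0 ≤ ρ₀ x
  source_differentiableOn : DifferentiableOn ℝ ρ₀ (interior A)
  source_integral : ∫ x in A, ρ₀ x = 1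
  target_pos : ∀ y ∈ Metric.closedBall (0 : EuclideanSpace ℝ (Fin d)) R, y ≠ 0 → 0 < ρ₁ y

end GaussTransport

end

/-! `H(r,·)` is the support function of `A_r`, so `T⁻¹(rθ)` is the point of `A_r` with outer normal
`θ`, and the eigenvalues `μ_i` of `H Id + D²H` are nonnegative. Since `P > 0`, the equation forces
`ρ₀(T⁻¹)`, `H_r` and every `μ_i` to be positive. Then each `x` with `φ x > 0` has exactly one outer
normal `θ` to its sublevel set, and `∇φ(x) = θ / H_r(φ x, θ)` (`exists_hasFDerivWithinAt`). Both
gradient bounds are thus inverted bounds on `H_r`.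

At `r = R`, `T⁻¹` inverts the Gauss map of `∂A`, so `det (H Id + D²H) = 1/K` and `H_r = P K / ρ₀`
(`radialDeriv_boundary`). For `r < R` the equation has the logarithmic derivative
(`logDeriv_polarDensity`) `P_r/P = ⟨∇ρ₀, (T⁻¹)_r⟩/ρ₀ + H_rr/H_r + tr((H Id + D²H)⁻¹ (H_r Id +
D²H_r))`, to which a maximum principle applies.

(a) At a minimum point of `H_r(r,·)`, `DH_r = 0` and `D²H_r ≥ 0`. The trace is at least `H_r ∑
1/μ_i`, which AM-GM and `∏ μ_i = P/(ρ₀ H_r)` bound below by `(d-1) H_r (ρ₀ H_r/C)^(1/(d-1))`. This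
absorbs the gradient term `-C ρ₀^(1/d) H_r` up to `C^(d+1)`, so `H_rr/H_r ≤ u + C^(d+1)` there.
Integrating the minimum of `log H_r` back from `r = R` gives the bound (`le_radialDeriv`).

(b) Consider a maximum point of `r^d exp((C+1)r) H_r / (H - εr/2)`. If it has `r < R`, put `c =
εr/2` and `q = H_r/(H - c)`. Tangency gives `DH_r = q DH` and `D²H_r ≤ q D²H`, so the trace is at
most `q(d-1) - q c ∑ 1/μ_i`. The exponential weight absorbs `P_r/P ≥ -C`, the factor `q` cancels,
and `c ∑ 1/μ_i` is bounded. By AM-GM `H_r` is at most a constant times `r^(1-d)`; dividing by `H - c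
≥ c` costs one more power of `r`, paid for by `r^d` (`exists_radialDeriv_le`). -/

section Gradient

/-! ### Euclidean gradients and Hessians. -/

variable {V : Type*} [NormedAddCommGroup V] [InnerProductSpace ℝ V] [CompleteSpace V]

theorem inner_gradient_eq_fderiv (f : V → ℝ) (x v : V) :
    inner ℝ (gradient f x) v = fderiv ℝ f x v := by
  rw [gradient, InnerProductSpace.toDual_symm_apply]

theorem ContDiffAt.differentiableAt_gradient {f : V → ℝ} {x : V} (hf : ContDiffAt ℝ 2 f x) :
    DifferentiableAt ℝ (gradient f) x := by
  have h : DifferentiableAt ℝ (fderiv ℝ f) x :=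
    (hf.fderiv_right (m := 1) (by norm_num)).differentiableAt one_ne_zero
  exact ((InnerProductSpace.toDual ℝ V).symm.toContinuousLinearEquiv.differentiableAt).comp x h

theorem inner_fderiv_gradient {f : V → ℝ} {x : V} (hf : ContDiffAt ℝ 2 f x) (v w : V) :
    inner ℝ (fderiv ℝ (gradient f) x v) w = fderiv ℝ (fderiv ℝ f) x v w := by
  have h : DifferentiableAt ℝ (fderiv ℝ f) x :=
    (hf.fderiv_right (m := 1) (by norm_num)).differentiableAt one_ne_zero
  have h1 : HasFDerivAt (fun y => inner ℝ (gradient f y) w)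
      ((innerSL ℝ w).comp (fderiv ℝ (gradient f) x)) x := by
    have := ((innerSL ℝ w).hasFDerivAt (x := gradient f x)).comp x
      hf.differentiableAt_gradient.hasFDerivAt
    refine this.congr_of_eventuallyEq (Eventually.of_forall fun y => ?_)
    simp
  have h2 : HasFDerivAt (fun y => inner ℝ (gradient f y) w)
      ((fderiv ℝ (fderiv ℝ f) x).flip w) x := by
    simp only [inner_gradient_eq_fderiv]
    exact ((ContinuousLinearMap.apply ℝ ℝ w).hasFDerivAt.comp x h.hasFDerivAt)
  have := DFunLike.congr_fun (h1.unique h2) v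
  simpa [real_inner_comm] using this

theorem inner_fderiv_gradient_symm {f : V → ℝ} {x : V} (hf : ContDiffAt ℝ 2 f x)
    (v w : V) :
    inner ℝ (fderiv ℝ (gradient f) x v) w = inner ℝ (fderiv ℝ (gradient f) x w) v := by
  rw [inner_fderiv_gradient hf, inner_fderiv_gradient hf]
  exact hf.isSymmSndFDerivAt (by simp) v w

end Gradient

namespace GaussTransport

variable {d : ℕ}

/-- The Euclidean space `ℝ^d`. -/
abbrev Euc (d : ℕ) : Type := EuclideanSpace ℝ (Fin d)

/-! ### Support functions of sublevel sets. -/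

section Support

variable {A : Set (Euc d)} {φ : Euc d → ℝ} {r s : ℝ} {θ x : Euc d}

theorem isCompact_sublevel (hA : IsCompact A) (hφ : ContinuousOn φ A) (r : ℝ) :
    IsCompact {x | x ∈ A ∧ φ x ≤ r} :=
  hA.of_isClosed_subset (hφ.preimage_isClosed_of_isClosed hA.isClosed isClosed_Iic)
    fun _ hx => hx.1

theorem inner_le_dualPotential (hA : IsCompact A) (θ : Euc d) (hx : x ∈ A) (hr : φ x ≤ r) :
    inner ℝ θ x ≤ dualPotential A φ r θ := by
  refine le_csSup ?_ ⟨x, ⟨hx, hr⟩, rfl⟩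
  refine ((hA.image (f := fun x => inner ℝ θ x) (by fun_prop)).bddAbove).mono ?_
  exact image_mono fun y hy => hy.1

theorem exists_inner_eq_dualPotential (hA : IsCompact A) (hφ : ContinuousOn φ A) (θ : Euc d)
    (hx : x ∈ A) (hr : φ x ≤ r) :
    ∃ y ∈ A, φ y ≤ r ∧ inner ℝ θ y = dualPotential A φ r θ := by
  obtain ⟨y, hy, h⟩ := (isCompact_sublevel hA hφ r).exists_sSup_image_eq ⟨x, hx, hr⟩
    (f := fun x => inner ℝ θ x) (by fun_prop)
  exact ⟨y, hy.1, hy.2, h.symm⟩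

theorem dualPotential_mono (hA : IsCompact A) (hφ : ContinuousOn φ A) (θ : Euc d)
    (hx : x ∈ A) (hr : φ x ≤ r) (hrs : r ≤ s) :
    dualPotential A φ r θ ≤ dualPotential A φ s θ := by
  obtain ⟨y, hy, h1, h2⟩ := exists_inner_eq_dualPotential hA hφ θ hx hr
  exact h2 ▸ inner_le_dualPotential hA θ hy (h1.trans hrs)

/-- Hahn-Banach separation, normalized to a unit vector. The point `z` of the sublevel set rules out
the zero functional. -/
theorem exists_dualPotential_lt (hA : IsCompact A) (hφ : ContinuousOn φ A)
    (hconv : Convex ℝ {x | x ∈ A ∧ φ x ≤ r}) {z : Euc d} (hz : z ∈ A) (hzr : φ z ≤ r)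
    (hx : ¬ (x ∈ A ∧ φ x ≤ r)) :
    ∃ θ ∈ Metric.sphere (0 : Euc d) 1, dualPotential A φ r θ < inner ℝ θ x := by
  obtain ⟨f, u, hf, hu⟩ := geometric_hahn_banach_closed_point hconv
    (isCompact_sublevel hA hφ r).isClosed hx
  set w := (InnerProductSpace.toDual ℝ (Euc d)).symm f with hw
  have hfw : ∀ y, f y = inner ℝ w y := fun y => by
    rw [hw, InnerProductSpace.toDual_symm_apply]
  have hw0 : w ≠ 0 := by
    intro h
    have h1 := hf z ⟨hz, hzr⟩
    rw [hfw, h, inner_zero_left] at h1 hu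
    exact absurd h1 hu.not_gt
  have hn : 0 < ‖w‖ := norm_pos_iff.2 hw0
  refine ⟨‖w‖⁻¹ • w, by simp [norm_smul, hn.ne'], ?_⟩
  obtain ⟨y, hy, h1, h2⟩ := exists_inner_eq_dualPotential hA hφ (‖w‖⁻¹ • w) hz hzr
  rw [← h2, real_inner_smul_left, real_inner_smul_left, ← hfw, ← hfw]
  have := (hf y ⟨hy, h1⟩).trans hu
  gcongr

end Support

/-! ### Differentiation on the sphere along great circles. -/

section SphereCalculus

variable {F : Euc d → ℝ} {θ v : Euc d}

theorem radialExt_smul (F : Euc d → ℝ) {c : ℝ} (hc : 0 < c) (x : Euc d) :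
    radialExt F (c • x) = radialExt F x := by
  unfold radialExt
  congr 1
  rw [norm_smul, smul_smul, Real.norm_of_nonneg hc.le, mul_inv_rev, mul_assoc,
    inv_mul_cancel₀ hc.ne', mul_one]

theorem radialExt_of_mem_sphere (F : Euc d → ℝ) (hθ : θ ∈ Metric.sphere (0 : Euc d) 1) :
    radialExt F θ = F θ := by
  rw [mem_sphere_zero_iff_norm] at hθ
  simp [radialExt, hθ]

theorem ne_zero_of_mem_sphere (hθ : θ ∈ Metric.sphere (0 : Euc d) 1) : θ ≠ 0 := by
  rw [mem_sphere_zero_iff_norm] at hθ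
  rintro rfl
  simp at hθ

theorem contDiffAt_radialExt (hF : ContDiffOn ℝ 2 (radialExt F) {0}ᶜ) {x : Euc d} (hx : x ≠ 0) :
    ContDiffAt ℝ 2 (radialExt F) x :=
  hF.contDiffAt (isOpen_compl_singleton.mem_nhds hx)

theorem inner_gradient_radialExt_self (hF : ContDiffOn ℝ 2 (radialExt F) {0}ᶜ) {x : Euc d}
    (hx : x ≠ 0) : inner ℝ (gradient (radialExt F) x) x = 0 := by
  have h1 : DifferentiableAt ℝ (radialExt F) x :=
    (contDiffAt_radialExt hF hx).differentiableAt two_ne_zero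
  have h2 : HasDerivAt (fun t : ℝ => t • x) x 1 := by
    simpa using (hasDerivAt_id (1 : ℝ)).smul_const x
  have h3 := HasFDerivAt.comp_hasDerivAt_of_eq (1 : ℝ) h1.hasFDerivAt h2 (one_smul ℝ x).symm
  have h4 : HasDerivAt (fun t : ℝ => radialExt F (t • x)) 0 1 := by
    refine (hasDerivAt_const (1 : ℝ) (radialExt F x)).congr_of_eventuallyEq ?_
    filter_upwards [lt_mem_nhds (show (0 : ℝ) < 1 by norm_num)] with t ht
    exact radialExt_smul F ht x
  rw [inner_gradient_eq_fderiv]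
  exact h3.unique h4

theorem inner_sphGrad_self (hF : ContDiffOn ℝ 2 (radialExt F) {0}ᶜ)
    (hθ : θ ∈ Metric.sphere (0 : Euc d) 1) : inner ℝ (sphGrad F θ) θ = 0 :=
  inner_gradient_radialExt_self hF (ne_zero_of_mem_sphere hθ)

/-- Obtained by differentiating the Euler relation `⟨∇F(y), y⟩ = 0` of a function constant along
rays. -/
theorem inner_fderiv_gradient_radialExt (hF : ContDiffOn ℝ 2 (radialExt F) {0}ᶜ) {x : Euc d}
    (hx : x ≠ 0) (v : Euc d) :
    inner ℝ (fderiv ℝ (gradient (radialExt F)) x v) x = - inner ℝ (gradient (radialExt F) x) v := by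
  have h1 := ((contDiffAt_radialExt hF hx).differentiableAt_gradient.hasFDerivAt).inner ℝ
    (hasFDerivAt_id x)
  have h2 : HasFDerivAt (fun y => inner ℝ (gradient (radialExt F) y) y)
      (0 : Euc d →L[ℝ] ℝ) x := by
    refine (hasFDerivAt_const (0 : ℝ) x).congr_of_eventuallyEq ?_
    filter_upwards [isOpen_compl_singleton.mem_nhds hx] with y hy
    exact inner_gradient_radialExt_self hF hy
  have := DFunLike.congr_fun (h1.unique h2) v
  simp at this
  rw [inner_gradient_eq_fderiv]
  linarith

theorem inner_compress (L : Euc d →L[ℝ] Euc d) (n : Euc d) (v w : (ℝ ∙ n)ᗮ) :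
    inner ℝ (compress L n v : (ℝ ∙ n)ᗮ) w = inner ℝ (L v) (w : Euc d) := by
  simp [compress]

theorem sphHessExt_apply (F : Euc d → ℝ) (θ : Euc d) (v : (ℝ ∙ θ)ᗮ) :
    sphHessExt F θ v = sphHess F θ v := by
  simp [sphHessExt]

theorem inner_sphHess_symm (hF : ContDiffOn ℝ 2 (radialExt F) {0}ᶜ)
    (hθ : θ ∈ Metric.sphere (0 : Euc d) 1) (v w : (ℝ ∙ θ)ᗮ) :
    inner ℝ (sphHess F θ v) w = inner ℝ v (sphHess F θ w) := by
  rw [real_inner_comm _ v, sphHess, inner_compress, inner_compress]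
  exact inner_fderiv_gradient_symm (contDiffAt_radialExt hF (ne_zero_of_mem_sphere hθ)) _ _

/-- The great circle through `θ` with initial velocity `v`. -/
noncomputable def greatCircle (θ v : Euc d) (t : ℝ) : Euc d := Real.cos t • θ + Real.sin t • v

/-- The velocity of the great circle through `θ` with initial velocity `v`. -/
noncomputable def greatCircleVel (θ v : Euc d) (t : ℝ) : Euc d := (-Real.sin t) • θ + Real.cos t • v

@[simp] theorem greatCircle_zero (θ v : Euc d) : greatCircle θ v 0 = θ := by simp [greatCircle]

@[simp] theorem greatCircleVel_zero (θ v : Euc d) : greatCircleVel θ v 0 = v := by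
  simp [greatCircleVel]

theorem hasDerivAt_greatCircle (θ v : Euc d) (t : ℝ) :
    HasDerivAt (greatCircle θ v) (greatCircleVel θ v t) t :=
  ((Real.hasDerivAt_cos t).smul_const θ).add ((Real.hasDerivAt_sin t).smul_const v)

theorem hasDerivAt_greatCircleVel (θ v : Euc d) (t : ℝ) :
    HasDerivAt (greatCircleVel θ v) (-greatCircle θ v t) t := by
  have := ((Real.hasDerivAt_sin t).neg.smul_const θ).add ((Real.hasDerivAt_cos t).smul_const v)
  refine this.congr_deriv ?_
  simp [greatCircle, add_comm]

theorem continuous_greatCircle (θ v : Euc d) : Continuous (greatCircle θ v) :=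
  continuous_iff_continuousAt.2 fun t => (hasDerivAt_greatCircle θ v t).continuousAt

theorem continuous_greatCircleVel (θ v : Euc d) : Continuous (greatCircleVel θ v) :=
  continuous_iff_continuousAt.2 fun t => (hasDerivAt_greatCircleVel θ v t).continuousAt

theorem greatCircle_mem_sphere (hθ : θ ∈ Metric.sphere (0 : Euc d) 1)
    (hv : v ∈ Metric.sphere (0 : Euc d) 1) (hθv : inner ℝ θ v = 0) (t : ℝ) :
    greatCircle θ v t ∈ Metric.sphere (0 : Euc d) 1 := by
  rw [mem_sphere_zero_iff_norm] at *
  have h : ‖greatCircle θ v t‖ ^ 2 = 1 := by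
    rw [greatCircle, norm_add_sq_real, norm_smul, norm_smul, hθ, hv, real_inner_smul_left,
      real_inner_smul_right, hθv]
    simp
  nlinarith [norm_nonneg (greatCircle θ v t)]

theorem inner_greatCircle_vel (hθ : θ ∈ Metric.sphere (0 : Euc d) 1)
    (hv : v ∈ Metric.sphere (0 : Euc d) 1) (hθv : inner ℝ θ v = 0) (t : ℝ) :
    inner ℝ (greatCircle θ v t) (greatCircleVel θ v t) = 0 := by
  rw [mem_sphere_zero_iff_norm] at *
  have hvθ : inner ℝ v θ = 0 := by rw [real_inner_comm, hθv]
  simp only [greatCircle, greatCircleVel, inner_add_left, inner_add_right, real_inner_smul_left,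
    real_inner_smul_right, real_inner_self_eq_norm_sq, hθ, hv, hθv, hvθ]
  ring

theorem hasDerivAt_greatCircle_comp (hF : ContDiffOn ℝ 2 (radialExt F) {0}ᶜ)
    (hθ : θ ∈ Metric.sphere (0 : Euc d) 1)
    (hv : v ∈ Metric.sphere (0 : Euc d) 1) (hθv : inner ℝ θ v = 0) (t : ℝ) :
    HasDerivAt (fun t => F (greatCircle θ v t))
      (inner ℝ (sphGrad F (greatCircle θ v t)) (greatCircleVel θ v t)) t := by
  have hm := greatCircle_mem_sphere hθ hv hθv
  have h1 := ((contDiffAt_radialExt hF (ne_zero_of_mem_sphere (hm t))).differentiableAt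
    two_ne_zero).hasFDerivAt.comp_hasDerivAt t (hasDerivAt_greatCircle θ v t)
  rw [sphGrad, inner_gradient_eq_fderiv]
  refine h1.congr_of_eventuallyEq (Eventually.of_forall fun s => ?_)
  exact (radialExt_of_mem_sphere F (hm s)).symm

theorem inner_sphHessExt (F : Euc d → ℝ) (θ : Euc d) {v w : Euc d} (hv : inner ℝ θ v = 0)
    (hw : inner ℝ θ w = 0) :
    inner ℝ (sphHessExt F θ v) w = inner ℝ (fderiv ℝ (gradient (radialExt F)) θ v) w := by
  have hv' : v ∈ (ℝ ∙ θ)ᗮ := Submodule.mem_orthogonal_singleton_iff_inner_right.2 hv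
  have hw' : w ∈ (ℝ ∙ θ)ᗮ := Submodule.mem_orthogonal_singleton_iff_inner_right.2 hw
  have h1 := sphHessExt_apply F θ ⟨v, hv'⟩
  have h2 := inner_compress (fderiv ℝ (gradient (radialExt F)) θ) θ ⟨v, hv'⟩ ⟨w, hw'⟩
  simp only at h1 h2
  rw [h1, ← h2]
  rfl

/-- The acceleration of a great circle is normal to the sphere, hence orthogonal to the tangential
gradient; only the Hessian term survives. -/
theorem hasDerivAt_inner_sphGrad_greatCircle (hF : ContDiffOn ℝ 2 (radialExt F) {0}ᶜ)
    (hθ : θ ∈ Metric.sphere (0 : Euc d) 1)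
    (hv : v ∈ Metric.sphere (0 : Euc d) 1) (hθv : inner ℝ θ v = 0) (t : ℝ) :
    HasDerivAt (fun t => inner ℝ (sphGrad F (greatCircle θ v t)) (greatCircleVel θ v t))
      (inner ℝ (sphHessExt F (greatCircle θ v t) (greatCircleVel θ v t))
        (greatCircleVel θ v t)) t := by
  have hm := greatCircle_mem_sphere hθ hv hθv
  have h1 := (contDiffAt_radialExt hF
    (ne_zero_of_mem_sphere (hm t))).differentiableAt_gradient.hasFDerivAt.comp_hasDerivAt t
      (hasDerivAt_greatCircle θ v t)
  have h2 := h1.inner ℝ (hasDerivAt_greatCircleVel θ v t)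
  have hi := inner_greatCircle_vel hθ hv hθv t
  rw [inner_sphHessExt _ _ hi hi]
  have h3 := inner_sphGrad_self hF (hm t)
  rw [sphGrad] at h3
  refine h2.congr_deriv ?_
  simp [h3]

end SphereCalculus

/-! ### Second-order condition and mixed partial derivatives. -/

section OneVariable

theorem second_deriv_nonneg_of_isLocalMin {q q₁ : ℝ → ℝ} {q₂ t₀ : ℝ}
    (h₁ : ∀ᶠ t in 𝓝 t₀, HasDerivAt q (q₁ t) t) (h₂ : HasDerivAt q₁ q₂ t₀)
    (hmin : IsLocalMin q t₀) : 0 ≤ q₂ := by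
  by_contra! hneg
  have hd : deriv q =ᶠ[𝓝 t₀] q₁ := h₁.mono fun t ht => ht.deriv
  -- If `q₂ < 0`, the minimum is also a local maximum, so `q` is constant near `t₀` and `q₂ = 0`, a
  -- contradiction.
  have hmax : IsLocalMax q t₀ := by
    refine isLocalMax_of_deriv_deriv_neg ?_ hmin.deriv_eq_zero h₁.self_of_nhds.continuousAt
    rwa [hd.deriv_eq, h₂.deriv]
  have hc : ∀ᶠ t in 𝓝 t₀, q t = q t₀ := by
    filter_upwards [hmin, hmax] with t h1 h2 using le_antisymm h2 h1
  have h0 : q₁ =ᶠ[𝓝 t₀] fun _ => 0 := by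
    filter_upwards [hc.eventually_nhds, h₁] with t ht ht1
    exact ht1.unique ((hasDerivAt_const t (q t₀)).congr_of_eventuallyEq ht)
  have := h₂.unique ((hasDerivAt_const t₀ (0 : ℝ)).congr_of_eventuallyEq h0)
  linarith

/-- Interchange of the partial derivatives of a function of two real variables. -/
theorem hasDerivAt_of_mixed_partial {a b b' : ℝ → ℝ → ℝ} {a' : ℝ → ℝ} {s₀ t₀ : ℝ}
    (ha : ∀ᶠ s in 𝓝 s₀, ∀ t, HasDerivAt (a s) (b s t) t)
    (ha' : ∀ t, HasDerivAt (fun s => a s t) (a' t) s₀)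
    (hb : ∀ᶠ s in 𝓝 s₀, ∀ t, HasDerivAt (fun s => b s t) (b' s t) s)
    (hcont : ContinuousAt (fun p : ℝ × ℝ => b' p.1 p.2) (s₀, t₀)) :
    HasDerivAt a' (b' s₀ t₀) t₀ := by
  rw [hasDerivAt_iff_isLittleO, Asymptotics.isLittleO_iff]
  intro ε hε
  have hc : ∀ᶠ p : ℝ × ℝ in 𝓝 (s₀, t₀), |b' p.1 p.2 - b' s₀ t₀| ≤ ε := by
    filter_upwards [hcont.eventually (Metric.closedBall_mem_nhds _ hε)] with p hp using hp
  rw [nhds_prod_eq, Filter.eventually_prod_iff] at hc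
  obtain ⟨P, hP, Q, hQ, hPQ⟩ := hc
  obtain ⟨δ₁, hδ₁, hball₁⟩ := Metric.eventually_nhds_iff_ball.1 (hP.and (ha.and hb))
  obtain ⟨δ₂, hδ₂, hball₂⟩ := Metric.eventually_nhds_iff_ball.1 hQ
  filter_upwards [Metric.ball_mem_nhds t₀ hδ₂] with t ht
  -- The mean value inequality is used twice: in `s`, to compare the increment of `b` with `(s - s₀)
  -- b'`, and then in `t`, for `a s - a s₀`. The result is a Lipschitz bound in `s` at `s₀`, which
  -- passes to the derivative.
  have hder : HasDerivAt (fun s => a s t - a s t₀ - (s * ((t - t₀) * b' s₀ t₀)))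
      (a' t - a' t₀ - (t - t₀) • b' s₀ t₀) s₀ := by
    have := ((ha' t).sub (ha' t₀)).sub ((hasDerivAt_id s₀).mul_const ((t - t₀) * b' s₀ t₀))
    exact this.congr_deriv (by simp)
  have hs₀ : s₀ ∈ Metric.ball s₀ δ₁ := Metric.mem_ball_self hδ₁
  refine hder.le_of_lip' (by positivity) ?_
  filter_upwards [Metric.ball_mem_nhds s₀ hδ₁] with s hs
  have hE : ∀ τ ∈ Metric.ball t₀ δ₂, HasDerivWithinAt
      (fun τ => a s τ - a s₀ τ - (s - s₀) * b' s₀ t₀ * τ)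
      (b s τ - b s₀ τ - (s - s₀) * b' s₀ t₀) (Metric.ball t₀ δ₂) τ := by
    intro τ _
    have := (((hball₁ s hs).2.1 τ).sub ((hball₁ s₀ hs₀).2.1 τ)).sub
      ((hasDerivAt_id τ).const_mul ((s - s₀) * b' s₀ t₀))
    exact (this.congr_deriv (by simp)).hasDerivWithinAt
  have hE' : ∀ τ ∈ Metric.ball t₀ δ₂, ‖b s τ - b s₀ τ - (s - s₀) * b' s₀ t₀‖ ≤ ε * ‖s - s₀‖ := by
    intro τ hτ
    have hF : ∀ σ ∈ Metric.ball s₀ δ₁, HasDerivWithinAt (fun σ => b σ τ - σ * b' s₀ t₀)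
        (b' σ τ - b' s₀ t₀) (Metric.ball s₀ δ₁) σ := by
      intro σ hσ
      have := ((hball₁ σ hσ).2.2 τ).sub ((hasDerivAt_id σ).mul_const (b' s₀ t₀))
      exact (this.congr_deriv (by simp)).hasDerivWithinAt
    have := (convex_ball s₀ δ₁).norm_image_sub_le_of_norm_hasDerivWithin_le hF
      (fun σ hσ => hPQ (hball₁ σ hσ).1 (hball₂ τ hτ)) hs₀ hs
    refine le_trans (le_of_eq ?_) this
    congr 1
    ring
  have := (convex_ball t₀ δ₂).norm_image_sub_le_of_norm_hasDerivWithin_le hE hE'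
    (Metric.mem_ball_self hδ₂) ht
  calc _ = ‖a s t - a s₀ t - (s - s₀) * b' s₀ t₀ * t
        - (a s t₀ - a s₀ t₀ - (s - s₀) * b' s₀ t₀ * t₀)‖ := by congr 1; ring
    _ ≤ _ := this
    _ = _ := by ring

end OneVariable

/-! ### First- and second-order conditions at a support point. -/

section SupportPoint

variable {F : Euc d → ℝ} {θ v y : Euc d}

/-- The function `η ↦ F η - ⟨η, y⟩` is nonnegative on the sphere and vanishes at `θ`. Both claims
are its minimality conditions along a great circle; the term `F θ` comes from the acceleration `-θ`
of the circle. -/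
theorem eq_add_sphGrad_of_forall_inner_le (hF : ContDiffOn ℝ 2 (radialExt F) {0}ᶜ)
    (hθ : θ ∈ Metric.sphere (0 : Euc d) 1)
    (hle : ∀ η ∈ Metric.sphere (0 : Euc d) 1, inner ℝ η y ≤ F η) (heq : inner ℝ θ y = F θ)
    (hv : v ∈ Metric.sphere (0 : Euc d) 1) (hθv : inner ℝ θ v = 0) :
    inner ℝ v y = inner ℝ v (sphGrad F θ) ∧ 0 ≤ inner ℝ (sphHessExt F θ v) v + F θ := by
  have hm := greatCircle_mem_sphere hθ hv hθv
  have h1 : ∀ t, HasDerivAt (fun t => F (greatCircle θ v t) - inner ℝ (greatCircle θ v t) y)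
      (inner ℝ (sphGrad F (greatCircle θ v t)) (greatCircleVel θ v t)
        - inner ℝ (greatCircleVel θ v t) y) t := fun t => by
    refine (hasDerivAt_greatCircle_comp hF hθ hv hθv t).sub ?_
    simpa using (hasDerivAt_greatCircle θ v t).inner ℝ (hasDerivAt_const t y)
  have h2 : HasDerivAt (fun t => inner ℝ (sphGrad F (greatCircle θ v t)) (greatCircleVel θ v t)
        - inner ℝ (greatCircleVel θ v t) y)
        (inner ℝ (sphHessExt F θ v) v + F θ) 0 := by
    have ha := hasDerivAt_inner_sphGrad_greatCircle hF hθ hv hθv 0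
    have hb := (hasDerivAt_greatCircleVel θ v 0).inner ℝ (hasDerivAt_const 0 y)
    refine (ha.sub hb).congr_deriv ?_
    simp [heq]
  have hmin : IsLocalMin (fun t => F (greatCircle θ v t) - inner ℝ (greatCircle θ v t) y) 0 := by
    refine Eventually.of_forall fun t => ?_
    have := hle _ (hm t)
    simp only [greatCircle_zero, heq, sub_self]
    linarith
  refine ⟨?_, second_deriv_nonneg_of_isLocalMin (Eventually.of_forall h1) h2 hmin⟩
  have := hmin.hasDerivAt_eq_zero (h1 0)
  simp only [greatCircle_zero, greatCircleVel_zero] at this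
  rw [real_inner_comm (sphGrad F θ) v]
  linarith

end SupportPoint

/-! ### Interchanging radial and spherical derivatives. -/

section RadialDerivative

variable {V : Type*} [NormedAddCommGroup V] [NormedSpace ℝ V] {R r : ℝ} {θ v : Euc d}

theorem IsC1InRadius.hasDerivWithinAt {G : ℝ → Euc d → V} (hG : IsC1InRadius R G)
    (hr : r ∈ Ioc 0 R) (hθ : θ ∈ Metric.sphere (0 : Euc d) 1) :
    HasDerivWithinAt (fun s => G s θ) (radialDeriv R G r θ) (Ioc 0 R) r :=
  (hG.differentiableOn θ hθ r hr).hasDerivWithinAt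

theorem IsC1InRadius.hasDerivAt {G : ℝ → Euc d → V} (hG : IsC1InRadius R G)
    (hr : r ∈ Ioo 0 R) (hθ : θ ∈ Metric.sphere (0 : Euc d) 1) :
    HasDerivAt (fun s => G s θ) (radialDeriv R G r θ) r :=
  (hG.hasDerivWithinAt (Ioo_subset_Ioc_self hr) hθ).hasDerivAt (Ioc_mem_nhds hr.1 hr.2)

theorem continuousAt_comp_greatCircle {Y : Type*} [TopologicalSpace Y] {G : ℝ → Euc d → Y}
    (hG : ContinuousOn (fun p : ℝ × Euc d => G p.1 p.2) (Ioc 0 R ×ˢ Metric.sphere 0 1))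
    (hr : r ∈ Ioo 0 R) (hθ : θ ∈ Metric.sphere (0 : Euc d) 1)
    (hv : v ∈ Metric.sphere (0 : Euc d) 1) (hθv : inner ℝ θ v = 0) (t : ℝ) :
    ContinuousAt (fun p : ℝ × ℝ => G p.1 (greatCircle θ v p.2)) (r, t) := by
  have hc : ContinuousOn (fun p : ℝ × ℝ => G p.1 (greatCircle θ v p.2)) (Ioo 0 R ×ˢ univ) := by
    refine hG.comp (f := fun p : ℝ × ℝ => (p.1, greatCircle θ v p.2)) ?_ ?_
    · exact (continuous_fst.prodMk
        ((continuous_greatCircle θ v).comp continuous_snd)).continuousOn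
    · exact fun p hp => ⟨Ioo_subset_Ioc_self hp.1, greatCircle_mem_sphere hθ hv hθv _⟩
  exact hc.continuousAt ((isOpen_Ioo.prod isOpen_univ).mem_nhds ⟨hr, trivial⟩)

variable {H : ℝ → Euc d → ℝ}

/-- `H_r` is not assumed differentiable in `θ`. Its first derivative along great circles, and its
second in the next lemma, come from the assumed radial derivatives of `DH` and `D²H` by interchange
of partial derivatives. -/
theorem IsSmoothPotential.hasDerivAt_radialDeriv_greatCircle (hH : IsSmoothPotential R H)
    (hr : r ∈ Ioo 0 R) (hθ : θ ∈ Metric.sphere (0 : Euc d) 1)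
    (hv : v ∈ Metric.sphere (0 : Euc d) 1) (hθv : inner ℝ θ v = 0) (t : ℝ) :
    HasDerivAt (fun t => radialDeriv R H r (greatCircle θ v t))
      (inner ℝ (radialDeriv R (fun r => sphGrad (H r)) r (greatCircle θ v t))
        (greatCircleVel θ v t)) t := by
  have hm := greatCircle_mem_sphere hθ hv hθv
  have hev : ∀ᶠ s in 𝓝 r, s ∈ Ioo 0 R := isOpen_Ioo.mem_nhds hr
  refine hasDerivAt_of_mixed_partial (a := fun s t => H s (greatCircle θ v t))
    (b := fun s t => inner ℝ (sphGrad (H s) (greatCircle θ v t)) (greatCircleVel θ v t))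
    (b' := fun s t => inner ℝ (radialDeriv R (fun r => sphGrad (H r)) s (greatCircle θ v t))
        (greatCircleVel θ v t)) ?_ ?_ ?_ ?_
  · filter_upwards [hev] with s hs t
    exact hasDerivAt_greatCircle_comp (hH.contDiffOn s (Ioo_subset_Ioc_self hs)) hθ hv hθv t
  · exact fun t => hH.c1.hasDerivAt hr (hm t)
  · filter_upwards [hev] with s hs t
    simpa using (hH.c1_sphGrad.hasDerivAt hs (hm t)).inner ℝ
      (hasDerivAt_const s (greatCircleVel θ v t))
  · exact (continuousAt_comp_greatCircle hH.c1_sphGrad.continuousOn_radialDeriv hr hθ hv hθv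
      t).inner ((continuous_greatCircleVel θ v).comp continuous_snd).continuousAt

theorem IsSmoothPotential.hasDerivAt_inner_radialDeriv_sphGrad_greatCircle
    (hH : IsSmoothPotential R H)
    (hr : r ∈ Ioo 0 R) (hθ : θ ∈ Metric.sphere (0 : Euc d) 1)
    (hv : v ∈ Metric.sphere (0 : Euc d) 1) (hθv : inner ℝ θ v = 0) (t : ℝ) :
    HasDerivAt (fun t => inner ℝ (radialDeriv R (fun r => sphGrad (H r)) r (greatCircle θ v t))
        (greatCircleVel θ v t))
      (inner ℝ (radialDeriv R (fun r => sphHessExt (H r)) r (greatCircle θ v t)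
        (greatCircleVel θ v t)) (greatCircleVel θ v t)) t := by
  have hm := greatCircle_mem_sphere hθ hv hθv
  have hev : ∀ᶠ s in 𝓝 r, s ∈ Ioo 0 R := isOpen_Ioo.mem_nhds hr
  refine hasDerivAt_of_mixed_partial
    (a := fun s t => inner ℝ (sphGrad (H s) (greatCircle θ v t)) (greatCircleVel θ v t))
    (b := fun s t => inner ℝ (sphHessExt (H s) (greatCircle θ v t) (greatCircleVel θ v t))
      (greatCircleVel θ v t))
    (b' := fun s t => inner ℝ (radialDeriv R (fun r => sphHessExt (H r)) s (greatCircle θ v t)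
        (greatCircleVel θ v t)) (greatCircleVel θ v t)) ?_ ?_ ?_ ?_
  · filter_upwards [hev] with s hs t
    exact hasDerivAt_inner_sphGrad_greatCircle (hH.contDiffOn s (Ioo_subset_Ioc_self hs))
      hθ hv hθv t
  · intro t
    simpa using (hH.c1_sphGrad.hasDerivAt hr (hm t)).inner ℝ
      (hasDerivAt_const r (greatCircleVel θ v t))
  · filter_upwards [hev] with s hs t
    simpa using ((hH.c1_sphHess.hasDerivAt hs (hm t)).clm_apply
      (hasDerivAt_const s (greatCircleVel θ v t))).inner ℝ
      (hasDerivAt_const s (greatCircleVel θ v t))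
  · have hvel : ContinuousAt (fun p : ℝ × ℝ => greatCircleVel θ v p.2) (r, t) :=
      ((continuous_greatCircleVel θ v).comp continuous_snd).continuousAt
    exact ((continuousAt_comp_greatCircle hH.c1_sphHess.continuousOn_radialDeriv hr hθ hv hθv
      t).clm_apply hvel).inner hvel

end RadialDerivative

end GaussTransport

/-! ### Derivative of a determinant, and AM-GM for eigenvalues. -/

section Determinant

variable {ι : Type*} [Fintype ι] [DecidableEq ι]

theorem hasDerivAt_matrix_det_of_eq_diagonal {N : ℝ → Matrix ι ι ℝ} {N' : Matrix ι ι ℝ}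
    {μ : ι → ℝ} {r : ℝ} (hN : ∀ i j, HasDerivAt (fun s => N s i j) (N' i j) r)
    (hr : N r = Matrix.diagonal μ) :
    HasDerivAt (fun s => (N s).det) (∑ i, (∏ j ∈ Finset.univ.erase i, μ j) * N' i i) r := by
  simp only [Matrix.det_apply]
  have h : HasDerivAt (fun s => ∑ σ : Equiv.Perm ι, Equiv.Perm.sign σ • ∏ i, N s (σ i) i)
      (∑ σ : Equiv.Perm ι, Equiv.Perm.sign σ •
        ∑ i, (∏ j ∈ Finset.univ.erase i, N r (σ j) j) • N' (σ i) i) r := by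
    refine HasDerivAt.fun_sum fun σ _ => ?_
    simp only [Units.smul_def, zsmul_eq_mul]
    exact (HasDerivAt.fun_finsetProd fun i _ => hN (σ i) i).const_mul _
  refine h.congr_deriv ?_
  rw [Finset.sum_eq_single (1 : Equiv.Perm ι)]
  · simp [hr]
  · intro σ _ hσ
    rw [Finset.sum_eq_zero, smul_zero]
    intro i _
    -- A nontrivial permutation moves at least two indices. After the factor `i` is differentiated,
    -- some off-diagonal factor remains, and it vanishes at `r`.
    obtain ⟨j, hji, hj⟩ : ∃ j, j ≠ i ∧ σ j ≠ j := by
      by_contra! hall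
      refine hσ (Equiv.ext fun k => ?_)
      by_cases hk : k = i
      · subst hk
        by_contra hne
        exact hne (σ.injective (hall (σ k) hne))
      · exact hall k hk
    rw [Finset.prod_eq_zero (Finset.mem_erase.2 ⟨hji, Finset.mem_univ j⟩), zero_smul]
    rw [hr, Matrix.diagonal_apply_ne _ hj]
  · simp

variable {W : Type*} [NormedAddCommGroup W] [InnerProductSpace ℝ W]

theorem ContinuousLinearMap.det_eq_det_inner (b : OrthonormalBasis ι ℝ W) (T : W →L[ℝ] W) :
    T.det = (Matrix.of fun i j => inner ℝ (b i) (T (b j))).det := by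
  rw [ContinuousLinearMap.det, ← LinearMap.det_toMatrix b.toBasis]
  congr 1
  ext i j
  rw [LinearMap.toMatrix_apply]
  simp [OrthonormalBasis.repr_apply_apply]

theorem hasDerivAt_det_of_eigenbasis {T : ℝ → W →L[ℝ] W} {T' : W →L[ℝ] W} {r : ℝ}
    (b : OrthonormalBasis ι ℝ W) {μ : ι → ℝ} (hb : ∀ i, T r (b i) = μ i • b i)
    (hμ : ∀ i, 0 < μ i) (hT : HasDerivAt T T' r) :
    HasDerivAt (fun s => (T s).det) ((T r).det * ∑ i, inner ℝ (b i) (T' (b i)) / μ i) r := by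
  have hd : (Matrix.of fun i j => inner ℝ (b i) (T r (b j))) = Matrix.diagonal μ := by
    ext i j
    simp only [Matrix.of_apply, hb, real_inner_smul_right, Matrix.diagonal_apply,
      b.inner_eq_ite]
    split_ifs with h
    · simp [h]
    · simp
  have h := hasDerivAt_matrix_det_of_eq_diagonal
    (N := fun s => Matrix.of fun i j => inner ℝ (b i) (T s (b j)))
    (N' := Matrix.of fun i j => inner ℝ (b i) (T' (b j))) (r := r) (fun i j => by
      simpa using (hasDerivAt_const r (b i)).inner ℝ (hT.clm_apply (hasDerivAt_const r (b j)))) hd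
  simp only [ContinuousLinearMap.det_eq_det_inner b]
  refine h.congr_deriv ?_
  rw [hd, Matrix.det_diagonal, Finset.mul_sum]
  refine Finset.sum_congr rfl fun i _ => ?_
  rw [← Finset.mul_prod_erase _ _ (Finset.mem_univ i), Matrix.of_apply]
  field_simp [(hμ i).ne']

theorem hasDerivAt_det_smul_id_add_comp {W' : Type*} [NormedAddCommGroup W']
    [InnerProductSpace ℝ W'] (p : W' →L[ℝ] W) (e : W →L[ℝ] W')
    {a : ℝ → ℝ} {a' r : ℝ} {L : ℝ → W' →L[ℝ] W'} {L' : W' →L[ℝ] W'}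
    (b : OrthonormalBasis ι ℝ W) {μ : ι → ℝ}
    (hb : ∀ i, (a r • ContinuousLinearMap.id ℝ W + p ∘L (L r ∘L e)) (b i) = μ i • b i)
    (hμ : ∀ i, 0 < μ i) (ha : HasDerivAt a a' r) (hL : HasDerivAt L L' r) :
    HasDerivAt (fun s => (a s • ContinuousLinearMap.id ℝ W + p ∘L (L s ∘L e)).det)
      ((a r • ContinuousLinearMap.id ℝ W + p ∘L (L r ∘L e)).det
        * ∑ i, (a' + inner ℝ (p (L' (e (b i)))) (b i)) / μ i) r := by
  have h1 : HasDerivAt (fun s => p ∘L (L s ∘L e)) (p ∘L (L' ∘L e)) r := by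
    simpa using (hasDerivAt_const r p).clm_comp (hL.clm_comp (hasDerivAt_const r e))
  refine (hasDerivAt_det_of_eigenbasis b hb hμ
    ((ha.smul_const (ContinuousLinearMap.id ℝ W)).add h1)).congr_deriv ?_
  congr 1
  refine Finset.sum_congr rfl fun i _ => ?_
  congr 1
  rw [add_apply, inner_add_right, smul_apply, ContinuousLinearMap.id_apply,
    real_inner_smul_right, real_inner_self_eq_norm_sq, b.norm_eq_one, real_inner_comm _ (b i)]
  simp

/-- The derivative `L'` is taken among endomorphisms of the whole space, as it is available for
`sphHessExt`, while the determinant is taken on the subspace. -/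
theorem hasDerivAt_det_smul_id_add_compression (K : Submodule ℝ W) [K.HasOrthogonalProjection]
    {a : ℝ → ℝ} {a' r : ℝ} {L : ℝ → W →L[ℝ] W} {L' : W →L[ℝ] W}
    (b : OrthonormalBasis ι ℝ K) {μ : ι → ℝ}
    (hb : ∀ i, (a r • ContinuousLinearMap.id ℝ K
      + K.orthogonalProjectionOnto ∘L (L r ∘L K.subtypeL)) (b i) = μ i • b i)
    (hμ : ∀ i, 0 < μ i) (ha : HasDerivAt a a' r) (hL : HasDerivAt L L' r) :
    HasDerivAt (fun s => (a s • ContinuousLinearMap.id ℝ K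
      + K.orthogonalProjectionOnto ∘L (L s ∘L K.subtypeL)).det)
      ((a r • ContinuousLinearMap.id ℝ K
        + K.orthogonalProjectionOnto ∘L (L r ∘L K.subtypeL)).det
        * ∑ i, (a' + inner ℝ (L' (b i)) (b i : W)) / μ i) r := by
  refine (hasDerivAt_det_smul_id_add_comp K.orthogonalProjectionOnto K.subtypeL b hb hμ ha
    hL).congr_deriv ?_
  simp

theorem exists_eigenbasis_of_inner_nonneg [FiniteDimensional ℝ W] {n : ℕ}
    (hn : Module.finrank ℝ W = n) {T : W →L[ℝ] W}
    (hsymm : ∀ v w, inner ℝ (T v) w = inner ℝ v (T w))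
    (hnonneg : ∀ v : W, ‖v‖ = 1 → 0 ≤ inner ℝ (T v) v) :
    ∃ (b : OrthonormalBasis (Fin n) ℝ W) (μ : Fin n → ℝ),
      (∀ i, T (b i) = μ i • b i) ∧ (∀ i, 0 ≤ μ i) ∧ T.det = ∏ i, μ i := by
  have hS : (T : W →ₗ[ℝ] W).IsSymmetric := hsymm
  refine ⟨hS.eigenvectorBasis hn, hS.eigenvalues hn, fun i => ?_, fun i => ?_, ?_⟩
  · exact hS.apply_eigenvectorBasis hn i
  · have h1 := hnonneg (hS.eigenvectorBasis hn i) ((hS.eigenvectorBasis hn).norm_eq_one i)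
    have h2 : T (hS.eigenvectorBasis hn i) = hS.eigenvalues hn i • hS.eigenvectorBasis hn i := by
      exact hS.apply_eigenvectorBasis hn i
    rw [h2, real_inner_smul_left, real_inner_self_eq_norm_sq,
      (hS.eigenvectorBasis hn).norm_eq_one i] at h1
    simpa using h1
  · simpa using hS.det_eq_prod_eigenvalues hn

/-- The arithmetic-geometric mean inequality for the reciprocals of positive numbers. -/
theorem card_mul_inv_prod_rpow_le_sum_inv {n : ℕ} (hn : 0 < n) {μ : Fin n → ℝ}
    (hμ : ∀ i, 0 < μ i) :
    (n : ℝ) * (∏ i, μ i)⁻¹ ^ (1 / (n : ℝ)) ≤ ∑ i, (μ i)⁻¹ := by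
  have hn' : (0 : ℝ) < n := by exact_mod_cast hn
  have h := Real.geom_mean_le_arith_mean_weighted Finset.univ (fun _ : Fin n => 1 / (n : ℝ))
    (fun i => (μ i)⁻¹) (fun _ _ => by positivity) (by simp [hn'.ne'])
    (fun i _ => (inv_pos.2 (hμ i)).le)
  rw [← Finset.mul_sum, Real.finsetProd_rpow _ _ fun i _ => (inv_pos.2 (hμ i)).le,
    Finset.prod_inv_distrib] at h
  rw [one_div, inv_mul_eq_div, le_div_iff₀ hn', mul_comm] at h
  simpa using h

end Determinant

/-! ### Consequences of the equation: positivity, interior points, logarithmic derivative. -/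

namespace GaussTransport

variable {d : ℕ} {R r s : ℝ} {A : Set (Euc d)} {φ ρ₀ ρ₁ ψ : Euc d → ℝ} {θ v x y : Euc d}

/-- A solution of the change of variables equation, with its regularity. -/
structure IsGaussTransport (R : ℝ) (A : Set (Euc d)) (φ ρ₀ ρ₁ : Euc d → ℝ) : Prop where
  data : IsGaussData R A φ ρ₀ ρ₁
  smooth : IsSmoothPotential R (dualPotential A φ)
  solves : SolvesChangeOfVariables R (dualPotential A φ) ρ₀ ρ₁

theorem eq_of_inner_eq_of_forall_orthogonal (hθ : inner ℝ θ x = inner ℝ θ y)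
    (h : ∀ v ∈ Metric.sphere (0 : Euc d) 1, inner ℝ θ v = 0 → inner ℝ v x = inner ℝ v y) :
    x = y := by
  by_contra hne
  have hu : x - y ≠ 0 := sub_ne_zero.2 hne
  have hn : ‖x - y‖ ≠ 0 := norm_ne_zero_iff.2 hu
  have h1 := h (‖x - y‖⁻¹ • (x - y)) (by simp [norm_smul, hn])
    (by rw [real_inner_smul_right, inner_sub_right, hθ, sub_self, mul_zero])
  rw [← sub_eq_zero, ← inner_sub_right, real_inner_smul_left, real_inner_self_eq_norm_sq] at h1
  simp [hn] at h1

theorem finrank_orthogonal_of_mem_sphere (hd : 2 ≤ d) (hθ : θ ∈ Metric.sphere (0 : Euc d) 1) :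
    Module.finrank ℝ (ℝ ∙ θ)ᗮ = d - 1 := by
  have : Fact (Module.finrank ℝ (Euc d) = (d - 1) + 1) := ⟨by
    rw [finrank_euclideanSpace_fin]; omega⟩
  exact Submodule.finrank_orthogonal_span_singleton (ne_zero_of_mem_sphere hθ)

namespace IsGaussTransport

theorem exists_inner_eq (h : IsGaussTransport R A φ ρ₀ ρ₁) (hr : 0 ≤ r) (θ : Euc d) :
    ∃ y ∈ A, φ y ≤ r ∧ inner ℝ θ y = dualPotential A φ r θ :=
  exists_inner_eq_dualPotential h.data.isCompact h.data.continuousOn θ h.data.zero_mem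
    (h.data.map_zero ▸ hr)

theorem eq_inverseTransport (h : IsGaussTransport R A φ ρ₀ ρ₁) (hr : r ∈ Ioc 0 R)
    (hθ : θ ∈ Metric.sphere (0 : Euc d) 1) (hy : y ∈ A) (hyr : φ y ≤ r)
    (heq : inner ℝ θ y = dualPotential A φ r θ) :
    y = inverseTransport (dualPotential A φ) r θ := by
  have hF := h.smooth.contDiffOn r hr
  refine eq_of_inner_eq_of_forall_orthogonal (θ := θ) ?_ fun v hv hθv => ?_
  · rw [inverseTransport, inner_add_right, real_inner_smul_right, real_inner_self_eq_norm_sq,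
      real_inner_comm (sphGrad _ _) θ, inner_sphGrad_self hF hθ, mem_sphere_zero_iff_norm.1 hθ, heq]
    simp
  · rw [(eq_add_sphGrad_of_forall_inner_le hF hθ (fun η _ =>
      inner_le_dualPotential h.data.isCompact η hy hyr) heq hv hθv).1, inverseTransport,
      inner_add_right, real_inner_smul_right, real_inner_comm θ v, hθv]
    simp

theorem inverseTransport_spec (h : IsGaussTransport R A φ ρ₀ ρ₁) (hr : r ∈ Ioc 0 R)
    (hθ : θ ∈ Metric.sphere (0 : Euc d) 1) :
    inverseTransport (dualPotential A φ) r θ ∈ A ∧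
    φ (inverseTransport (dualPotential A φ) r θ) ≤ r ∧
    inner ℝ θ (inverseTransport (dualPotential A φ) r θ) = dualPotential A φ r θ := by
  obtain ⟨y, hy, hyr, heq⟩ := h.exists_inner_eq hr.1.le θ
  rw [← h.eq_inverseTransport hr hθ hy hyr heq]
  exact ⟨hy, hyr, heq⟩

theorem inner_sphHessExt_add_nonneg (h : IsGaussTransport R A φ ρ₀ ρ₁) (hr : r ∈ Ioc 0 R)
    (hθ : θ ∈ Metric.sphere (0 : Euc d) 1) (hv : v ∈ Metric.sphere (0 : Euc d) 1)
    (hθv : inner ℝ θ v = 0) :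
    0 ≤ inner ℝ (sphHessExt (dualPotential A φ r) θ v) v + dualPotential A φ r θ := by
  obtain ⟨y, hy, hyr, heq⟩ := h.exists_inner_eq hr.1.le θ
  exact (eq_add_sphGrad_of_forall_inner_le (h.smooth.contDiffOn r hr) hθ (fun η _ =>
      inner_le_dualPotential h.data.isCompact η hy hyr) heq hv hθv).2

theorem polarDensity_pos (h : IsGaussTransport R A φ ρ₀ ρ₁) (hr : r ∈ Ioc 0 R)
    (hθ : θ ∈ Metric.sphere (0 : Euc d) 1) : 0 < polarDensity ρ₁ r θ := by
  refine mul_pos (h.data.target_pos _ ?_ ?_) (pow_pos hr.1 _)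
  · rw [mem_closedBall_zero_iff, norm_smul, mem_sphere_zero_iff_norm.1 hθ,
      Real.norm_of_nonneg hr.1.le, mul_one]
    exact hr.2
  · exact smul_ne_zero hr.1.ne' (ne_zero_of_mem_sphere hθ)

theorem exists_eigenbasis_nonneg (h : IsGaussTransport R A φ ρ₀ ρ₁) (hd : 2 ≤ d)
    (hr : r ∈ Ioc 0 R) (hθ : θ ∈ Metric.sphere (0 : Euc d) 1) :
    ∃ (b : OrthonormalBasis (Fin (d - 1)) ℝ (ℝ ∙ θ)ᗮ) (μ : Fin (d - 1) → ℝ),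
      (∀ i, (dualPotential A φ r θ • ContinuousLinearMap.id ℝ (ℝ ∙ θ)ᗮ
        + sphHess (dualPotential A φ r) θ) (b i) = μ i • b i) ∧ (∀ i, 0 ≤ μ i) ∧
      curvatureDet (dualPotential A φ) r θ = ∏ i, μ i := by
  have hF := h.smooth.contDiffOn r hr
  refine exists_eigenbasis_of_inner_nonneg (finrank_orthogonal_of_mem_sphere hd hθ) ?_ ?_
  · intro v w
    simp only [add_apply, smul_apply, ContinuousLinearMap.id_apply, inner_add_left,
      inner_add_right, real_inner_smul_left, real_inner_smul_right, inner_sphHess_symm hF hθ]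
  · intro v hv
    have hθv : inner ℝ θ (v : Euc d) = 0 :=
      Submodule.mem_orthogonal_singleton_iff_inner_right.1 v.2
    have h1 := h.inner_sphHessExt_add_nonneg hr hθ (v := (v : Euc d))
      (mem_sphere_zero_iff_norm.2 (by simpa using hv)) hθv
    rw [sphHessExt_apply] at h1
    simp only [add_apply, smul_apply, ContinuousLinearMap.id_apply, inner_add_left,
      real_inner_smul_left, real_inner_self_eq_norm_sq, hv]
    rw [add_comm]
    simpa using h1

theorem radialDeriv_nonneg (h : IsGaussTransport R A φ ρ₀ ρ₁) (θ : Euc d) :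
    0 ≤ radialDeriv R (dualPotential A φ) r θ := by
  refine MonotoneOn.derivWithin_nonneg fun s hs t _ hst => ?_
  exact dualPotential_mono h.data.isCompact h.data.continuousOn θ h.data.zero_mem
    (h.data.map_zero ▸ hs.1.le) hst

/-- The three factors are nonnegative (a density, the radial derivative of a monotone function, a
product of nonnegative eigenvalues) and their product `P` is positive. -/
theorem pos (h : IsGaussTransport R A φ ρ₀ ρ₁) (hd : 2 ≤ d) (hr : r ∈ Ioc 0 R)
    (hθ : θ ∈ Metric.sphere (0 : Euc d) 1) :
    0 < ρ₀ (inverseTransport (dualPotential A φ) r θ) ∧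
    0 < radialDeriv R (dualPotential A φ) r θ ∧ 0 < curvatureDet (dualPotential A φ) r θ := by
  have hP := (h.polarDensity_pos hr hθ).ne'
  rw [h.solves r hr θ hθ] at hP
  obtain ⟨b, μ, -, hμ, hdet⟩ := h.exists_eigenbasis_nonneg hd hr hθ
  have h1 := h.data.source_nonneg _ (h.inverseTransport_spec hr hθ).1
  have h2 := h.radialDeriv_nonneg (r := r) θ
  have h3 : 0 ≤ curvatureDet (dualPotential A φ) r θ :=
    hdet ▸ Finset.prod_nonneg fun i _ => hμ i
  refine ⟨h1.lt_of_ne' ?_, h2.lt_of_ne' ?_, h3.lt_of_ne' ?_⟩ <;>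
  · intro h0
    simp [h0] at hP

theorem exists_eigenbasis (h : IsGaussTransport R A φ ρ₀ ρ₁) (hd : 2 ≤ d)
    (hr : r ∈ Ioc 0 R) (hθ : θ ∈ Metric.sphere (0 : Euc d) 1) :
    ∃ (b : OrthonormalBasis (Fin (d - 1)) ℝ (ℝ ∙ θ)ᗮ) (μ : Fin (d - 1) → ℝ),
      (∀ i, (dualPotential A φ r θ • ContinuousLinearMap.id ℝ (ℝ ∙ θ)ᗮ
        + sphHess (dualPotential A φ r) θ) (b i) = μ i • b i) ∧ (∀ i, 0 < μ i) ∧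
      curvatureDet (dualPotential A φ) r θ = ∏ i, μ i := by
  obtain ⟨b, μ, hb, hμ, hdet⟩ := h.exists_eigenbasis_nonneg hd hr hθ
  have hpos := (h.pos hd hr hθ).2.2.ne'
  rw [hdet, Finset.prod_ne_zero_iff] at hpos
  exact ⟨b, μ, hb, fun i => (hμ i).lt_of_ne' (hpos i (Finset.mem_univ i)), hdet⟩

theorem strictMonoOn (h : IsGaussTransport R A φ ρ₀ ρ₁) (hd : 2 ≤ d)
    (hθ : θ ∈ Metric.sphere (0 : Euc d) 1) :
    StrictMonoOn (fun s => dualPotential A φ s θ) (Ioc 0 R) := by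
  refine strictMonoOn_of_hasDerivWithinAt_pos (convex_Ioc 0 R)
    (f' := fun s => radialDeriv R (dualPotential A φ) s θ)
    (h.smooth.c1.differentiableOn θ hθ).continuousOn ?_ ?_
  · intro s hs
    exact (h.smooth.c1.hasDerivWithinAt (interior_subset hs) hθ).mono interior_subset
  · exact fun s hs => (h.pos hd (interior_subset hs) hθ).2.1

theorem mem_of_forall_inner_le (h : IsGaussTransport R A φ ρ₀ ρ₁) (hr : 0 ≤ r)
    (hx : ∀ θ ∈ Metric.sphere (0 : Euc d) 1, inner ℝ θ x ≤ dualPotential A φ r θ) :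
    x ∈ A ∧ φ x ≤ r := by
  by_contra hn
  obtain ⟨θ, hθ, hlt⟩ := exists_dualPotential_lt h.data.isCompact h.data.continuousOn
    (h.data.convex_sublevel r) h.data.zero_mem (h.data.map_zero ▸ hr) hn
  exact absurd (hx θ hθ) hlt.not_ge

theorem continuousOn_dualPotential (h : IsGaussTransport R A φ ρ₀ ρ₁) (hr : r ∈ Ioc 0 R) :
    ContinuousOn (dualPotential A φ r) (Metric.sphere 0 1) := by
  refine h.smooth.c1.continuousOn.comp (f := fun θ => (r, θ)) (by fun_prop) ?_
  exact fun θ hθ => ⟨hr, hθ⟩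

/-- By compactness `H(R,·) - H(r,·)` has a positive minimum `δ` on the sphere, so the ball of radius
`δ` about a point of `A_r` lies in `A_R`. This places `T⁻¹(rθ)`, for `r < R`, where `ρ₀` is
differentiable. -/
theorem mem_interior_of_lt (h : IsGaussTransport R A φ ρ₀ ρ₁) (hd : 2 ≤ d)
    (hr : r ∈ Ioo 0 R) (hx : x ∈ A) (hxr : φ x ≤ r) : x ∈ interior A := by
  have hR : R ∈ Ioc 0 R := ⟨hr.1.trans hr.2, le_rfl⟩
  have hr' := Ioo_subset_Ioc_self hr
  have : Nonempty (Fin d) := ⟨⟨0, by omega⟩⟩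
  obtain ⟨θ₀, hθ₀, hmin⟩ := (isCompact_sphere (0 : Euc d) 1).exists_isMinOn
    (NormedSpace.sphere_nonempty.2 zero_le_one)
    ((h.continuousOn_dualPotential hR).sub (h.continuousOn_dualPotential hr'))
  set δ := dualPotential A φ R θ₀ - dualPotential A φ r θ₀ with hδ
  have hδ0 : 0 < δ := sub_pos.2 (h.strictMonoOn hd hθ₀ hr' hR hr.2)
  rw [mem_interior_iff_mem_nhds]
  filter_upwards [Metric.ball_mem_nhds x hδ0] with y hy
  refine (h.mem_of_forall_inner_le hR.1.le fun θ hθ => ?_).1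
  have h1 : inner ℝ θ x ≤ dualPotential A φ r θ :=
    inner_le_dualPotential h.data.isCompact θ hx hxr
  have h2 : δ ≤ dualPotential A φ R θ - dualPotential A φ r θ := hmin hθ
  have h3 : inner ℝ θ (y - x) ≤ ‖y - x‖ := by
    simpa [mem_sphere_zero_iff_norm.1 hθ] using real_inner_le_norm θ (y - x)
  rw [inner_sub_right] at h3
  rw [mem_ball_iff_norm] at hy
  linarith

theorem inverseTransport_mem_interior (h : IsGaussTransport R A φ ρ₀ ρ₁) (hd : 2 ≤ d)
    (hr : r ∈ Ioo 0 R) (hθ : θ ∈ Metric.sphere (0 : Euc d) 1) :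
    inverseTransport (dualPotential A φ) r θ ∈ interior A := by
  have := h.inverseTransport_spec (Ioo_subset_Ioc_self hr) hθ
  exact h.mem_interior_of_lt hd hr this.1 this.2.1

theorem sphHess_eq (F : Euc d → ℝ) (θ : Euc d) :
    sphHess F θ = ((ℝ ∙ θ)ᗮ).orthogonalProjectionOnto ∘L (sphHessExt F θ ∘L ((ℝ ∙ θ)ᗮ).subtypeL) := by
  ext v
  simp [sphHessExt]

/-- The logarithmic derivative in `r` of the change of variables equation. -/
theorem logDeriv_polarDensity (h : IsGaussTransport R A φ ρ₀ ρ₁)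
    (hd : 2 ≤ d) (hr : r ∈ Ioo 0 R) (hθ : θ ∈ Metric.sphere (0 : Euc d) 1) :
    ∃ (b : OrthonormalBasis (Fin (d - 1)) ℝ (ℝ ∙ θ)ᗮ) (μ : Fin (d - 1) → ℝ),
      (∀ i, 0 < μ i) ∧ curvatureDet (dualPotential A φ) r θ = ∏ i, μ i ∧
      (∀ i, μ i = dualPotential A φ r θ
        + inner ℝ (sphHessExt (dualPotential A φ r) θ (b i)) (b i : Euc d)) ∧
      deriv (fun s => polarDensity ρ₁ s θ) r / polarDensity ρ₁ r θ =
        inner ℝ (gradient ρ₀ (inverseTransport (dualPotential A φ) r θ))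
          (radialDeriv R (dualPotential A φ) r θ • θ
            + radialDeriv R (fun r => sphGrad (dualPotential A φ r)) r θ)
          / ρ₀ (inverseTransport (dualPotential A φ) r θ)
        + radialDeriv R (radialDeriv R (dualPotential A φ)) r θ
          / radialDeriv R (dualPotential A φ) r θ
        + ∑ i, (radialDeriv R (dualPotential A φ) r θ
          + inner ℝ (radialDeriv R (fun r => sphHessExt (dualPotential A φ r)) r θ (b i))
            (b i : Euc d)) / μ i := by
  have hr' := Ioo_subset_Ioc_self hr
  obtain ⟨b, μ, hb, hμ, hdet⟩ := h.exists_eigenbasis hd hr' hθ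
  refine ⟨b, μ, hμ, hdet, fun i => ?_, ?_⟩
  · have := congrArg (fun w => inner ℝ w (b i)) (hb i)
    simp only [add_apply, smul_apply, ContinuousLinearMap.id_apply, inner_add_left,
      real_inner_smul_left, real_inner_self_eq_norm_sq, b.norm_eq_one] at this
    rw [sphHessExt_apply]
    simp only [one_pow, mul_one, Submodule.coe_inner] at this
    exact this.symm
  obtain ⟨hp1, hp2, hp3⟩ := h.pos hd hr' hθ
  have hT : HasDerivAt (fun s => inverseTransport (dualPotential A φ) s θ)
      (radialDeriv R (dualPotential A φ) r θ • θ
            + radialDeriv R (fun r => sphGrad (dualPotential A φ r)) r θ) r :=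
    ((h.smooth.c1.hasDerivAt hr hθ).smul_const θ).add (h.smooth.c1_sphGrad.hasDerivAt hr hθ)
  have hρ : HasDerivAt (fun s => ρ₀ (inverseTransport (dualPotential A φ) s θ))
      (inner ℝ (gradient ρ₀ (inverseTransport (dualPotential A φ) r θ))
          (radialDeriv R (dualPotential A φ) r θ • θ
            + radialDeriv R (fun r => sphGrad (dualPotential A φ r)) r θ)) r := by
    rw [inner_gradient_eq_fderiv]
    exact ((h.data.source_differentiableOn.differentiableAt (isOpen_interior.mem_nhds
      (h.inverseTransport_mem_interior hd hr hθ))).hasFDerivAt).comp_hasDerivAt r hT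
  have hM : HasDerivAt (fun s => curvatureDet (dualPotential A φ) s θ)
      (curvatureDet (dualPotential A φ) r θ * ∑ i, (radialDeriv R (dualPotential A φ) r θ
          + inner ℝ (radialDeriv R (fun r => sphHessExt (dualPotential A φ r)) r θ (b i))
            (b i : Euc d)) / μ i) r := by
    simp only [sphHess_eq] at hb
    simp only [curvatureDet, sphHess_eq]
    exact hasDerivAt_det_smul_id_add_compression _ b hb hμ (h.smooth.c1.hasDerivAt hr hθ)
      (h.smooth.c1_sphHess.hasDerivAt hr hθ)
  have hP : HasDerivAt (fun s => polarDensity ρ₁ s θ) _ r :=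
    ((hρ.mul (h.smooth.c1_radialDeriv.hasDerivAt hr hθ)).mul hM).congr_of_eventuallyEq (by
      filter_upwards [isOpen_Ioo.mem_nhds hr] with s hs
      exact h.solves s (Ioo_subset_Ioc_self hs) θ hθ)
  rw [hP.deriv, h.solves r hr' θ hθ]
  simp only [Pi.mul_apply]
  field_simp

end IsGaussTransport

/-! ### Uniqueness of normals and differentiability of the potential. -/

theorem fderiv_gradient_radialExt_apply {F : Euc d → ℝ} (hF : ContDiffOn ℝ 2 (radialExt F) {0}ᶜ)
    (hθ : θ ∈ Metric.sphere (0 : Euc d) 1) (hθv : inner ℝ θ v = 0) :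
    fderiv ℝ (gradient (radialExt F)) θ v
      = sphHessExt F θ v - (inner ℝ (sphGrad F θ) v : ℝ) • θ := by
  have hv' : v ∈ (ℝ ∙ θ)ᗮ := Submodule.mem_orthogonal_singleton_iff_inner_right.2 hθv
  refine eq_of_inner_eq_of_forall_orthogonal (θ := θ) ?_ fun w hw hθw => ?_
  · have h1 : inner ℝ θ (sphHessExt F θ v) = 0 := by
      rw [sphHessExt_apply F θ ⟨v, hv'⟩]
      exact Submodule.mem_orthogonal_singleton_iff_inner_right.1 (sphHess F θ ⟨v, hv'⟩).2
    rw [real_inner_comm, inner_fderiv_gradient_radialExt hF (ne_zero_of_mem_sphere hθ),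
      inner_sub_right, h1, real_inner_smul_right, real_inner_self_eq_norm_sq,
      mem_sphere_zero_iff_norm.1 hθ, sphGrad]
    simp
  · rw [real_inner_comm, ← inner_sphHessExt F θ hθv hθw, inner_sub_right, real_inner_smul_right,
      real_inner_comm θ w, hθw, real_inner_comm w]
    simp

/-- The normal part of the derivative of `DH` cancels the derivative of the coefficient in `H θ`, so
the differential of `T⁻¹` on the sphere is `H Id + D²H`. -/
theorem hasDerivAt_inverseTransport_greatCircle {H : ℝ → Euc d → ℝ}
    (hF : ContDiffOn ℝ 2 (radialExt (H r)) {0}ᶜ) (hθ : θ ∈ Metric.sphere (0 : Euc d) 1)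
    (hv : v ∈ Metric.sphere (0 : Euc d) 1) (hθv : inner ℝ θ v = 0) :
    HasDerivAt (fun t => inverseTransport H r (greatCircle θ v t))
      (H r θ • v + sphHessExt (H r) θ v) 0 := by
  have h1 := (hasDerivAt_greatCircle_comp hF hθ hv hθv 0).smul (hasDerivAt_greatCircle θ v 0)
  have h2 := HasFDerivAt.comp_hasDerivAt_of_eq (0 : ℝ) (contDiffAt_radialExt hF
    (ne_zero_of_mem_sphere hθ)).differentiableAt_gradient.hasFDerivAt
      (hasDerivAt_greatCircle θ v 0) (greatCircle_zero θ v).symm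
  refine (h1.add h2).congr_deriv ?_
  simp only [greatCircle_zero, greatCircleVel_zero, fderiv_gradient_radialExt_apply hF hθ hθv]
  abel

theorem eq_zero_of_det_ne_zero {W : Type*} [NormedAddCommGroup W]
    [NormedSpace ℝ W] [FiniteDimensional ℝ W] {T : W →L[ℝ] W} (hT : T.det ≠ 0) {v : W} (hv : T v = 0) : v = 0 := by
  have := (LinearMap.equivOfDetNeZero (T : W →ₗ[ℝ] W) hT).injective.eq_iff (a := v) (b := 0)
  simpa [hv] using this

namespace IsGaussTransport

theorem smul_add_sphHessExt_ne_zero (h : IsGaussTransport R A φ ρ₀ ρ₁) (hd : 2 ≤ d)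
    (hr : r ∈ Ioc 0 R) (hθ : θ ∈ Metric.sphere (0 : Euc d) 1)
    (hv : v ∈ Metric.sphere (0 : Euc d) 1) (hθv : inner ℝ θ v = 0) :
    dualPotential A φ r θ • v + sphHessExt (dualPotential A φ r) θ v ≠ 0 := by
  intro h0
  have hv' : v ∈ (ℝ ∙ θ)ᗮ := Submodule.mem_orthogonal_singleton_iff_inner_right.2 hθv
  have h1 : (⟨v, hv'⟩ : (ℝ ∙ θ)ᗮ) = 0 := by
    refine eq_zero_of_det_ne_zero (h.pos hd hr hθ).2.2.ne' ?_
    ext1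
    rw [sphHessExt_apply (dualPotential A φ r) θ ⟨v, hv'⟩] at h0
    simpa using h0
  exact ne_zero_of_mem_sphere hv (congrArg Subtype.val h1)

theorem dualPotential_pos (h : IsGaussTransport R A φ ρ₀ ρ₁) (hd : 2 ≤ d)
    (hr : r ∈ Ioc 0 R) (hθ : θ ∈ Metric.sphere (0 : Euc d) 1) : 0 < dualPotential A φ r θ := by
  have hr2 : r / 2 ∈ Ioc 0 R := ⟨half_pos hr.1, (half_le_self hr.1.le).trans hr.2⟩
  refine lt_of_le_of_lt ?_ (h.strictMonoOn hd hθ hr2 hr (half_lt_self hr.1))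
  simpa using inner_le_dualPotential h.data.isCompact θ h.data.zero_mem
    (r := r / 2) (h.data.map_zero ▸ hr2.1.le)

/-- The outer normal of a sublevel set is unique. -/
theorem normal_unique (h : IsGaussTransport R A φ ρ₀ ρ₁) (hd : 2 ≤ d) (hr : r ∈ Ioc 0 R)
    {η : Euc d} (hθ : θ ∈ Metric.sphere (0 : Euc d) 1) (hη : η ∈ Metric.sphere (0 : Euc d) 1)
    (hx : x ∈ A) (hxr : φ x ≤ r) (hθx : inner ℝ θ x = dualPotential A φ r θ)
    (hηx : inner ℝ η x = dualPotential A φ r η) : η = θ := by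
  have hle : ∀ w : Euc d, ∀ z ∈ A, φ z ≤ r → inner ℝ w z ≤ dualPotential A φ r w :=
    fun w z hz hzr => inner_le_dualPotential h.data.isCompact w hz hzr
  have hnθ := mem_sphere_zero_iff_norm.1 hθ
  have hnη := mem_sphere_zero_iff_norm.1 hη
  set a : ℝ := inner ℝ θ η with ha
  set u := η - a • θ with hu
  -- If `η` is parallel to `θ`, then `η = -θ` is impossible because `H` is positive in both
  -- directions. Otherwise every direction on the short arc from `θ` to `η` is also normal at `x`,
  -- so `T⁻¹` is constant on an initial piece of the arc, against the injectivity of its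
  -- differential.
  by_cases hu0 : u = 0
  · have hηa : η = a • θ := sub_eq_zero.1 hu0
    have habs : |a| = 1 := by
      have := congrArg norm hηa
      rwa [norm_smul, hnη, hnθ, mul_one, eq_comm] at this
    rcases eq_or_eq_neg_of_abs_eq habs with h1 | h1
    · rw [hηa, h1, one_smul]
    · have h2 := h.dualPotential_pos hd hr hθ
      have h3 := h.dualPotential_pos hd hr hη
      rw [← hθx] at h2
      rw [← hηx, hηa, h1, real_inner_smul_left] at h3
      linarith
  exfalso
  have hb : 0 < ‖u‖ := norm_pos_iff.2 hu0
  have hθv : inner ℝ θ (‖u‖⁻¹ • u) = 0 := by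
    rw [real_inner_smul_right, hu, inner_sub_right, real_inner_smul_right,
      real_inner_self_eq_norm_sq, hnθ, ← ha]
    ring
  have hv : ‖u‖⁻¹ • u ∈ Metric.sphere (0 : Euc d) 1 := by simp [norm_smul, hb.ne']
  set w := ‖u‖⁻¹ • u with hw
  have hηw : η = a • θ + ‖u‖ • w := by
    rw [hw, smul_inv_smul₀ hb.ne', hu]
    abel
  have hcoef : ∀ᶠ t in 𝓝[>] (0 : ℝ), 0 ≤ Real.cos t - a / ‖u‖ * Real.sin t ∧
      0 ≤ Real.sin t / ‖u‖ := by
    have h1 : Tendsto (fun t => Real.cos t - a / ‖u‖ * Real.sin t) (𝓝[>] 0) (𝓝 1) := by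
      have : Continuous fun t => Real.cos t - a / ‖u‖ * Real.sin t := by fun_prop
      simpa using (this.tendsto 0).mono_left nhdsWithin_le_nhds
    filter_upwards [h1.eventually (lt_mem_nhds zero_lt_one),
      Ioo_mem_nhdsGT Real.pi_pos] with t ht1 ht2
    exact ⟨ht1.le, div_nonneg (Real.sin_pos_of_mem_Ioo ht2).le hb.le⟩
  have hconst : ∀ᶠ t in 𝓝[>] (0 : ℝ),
      inverseTransport (dualPotential A φ) r (greatCircle θ w t) = x := by
    filter_upwards [hcoef] with t ht
    have hgm := greatCircle_mem_sphere hθ hv hθv t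
    refine (h.eq_inverseTransport hr hgm hx hxr
      (le_antisymm (hle _ x hx hxr) ?_)).symm
    obtain ⟨z, hz, hzr, hzeq⟩ := h.exists_inner_eq hr.1.le (greatCircle θ w t)
    have hg : greatCircle θ w t
        = (Real.cos t - a / ‖u‖ * Real.sin t) • θ + (Real.sin t / ‖u‖) • η := by
      rw [hηw, greatCircle]
      match_scalars <;> field_simp
      ring
    rw [← hzeq, hg, inner_add_left, inner_add_left, real_inner_smul_left, real_inner_smul_left,
      real_inner_smul_left, real_inner_smul_left, hθx, hηx]
    have h1 := mul_le_mul_of_nonneg_left (hle θ z hz hzr) ht.1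
    have h2 := mul_le_mul_of_nonneg_left (hle η z hz hzr) ht.2
    linarith
  have h1 := (hasDerivAt_inverseTransport_greatCircle (h.smooth.contDiffOn r hr) hθ hv
    hθv).hasDerivWithinAt (s := Ioi 0)
  have h0 : inverseTransport (dualPotential A φ) r (greatCircle θ w 0) = x := by
    rw [greatCircle_zero]
    exact (h.eq_inverseTransport hr hθ hx hxr hθx).symm
  have h2 : HasDerivWithinAt
      (fun t => inverseTransport (dualPotential A φ) r (greatCircle θ w t)) 0 (Ioi 0) 0 :=
    (hasDerivWithinAt_const (0 : ℝ) (Ioi 0) x).congr_of_eventuallyEq hconst h0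
  exact h.smul_add_sphHessExt_ne_zero hd hr hθ hv hθv
    ((uniqueDiffWithinAt_Ioi (0 : ℝ)).eq_deriv _ h1 h2)

/-- For `s < φ x` the point `x` lies outside `A_s` and is strictly separated from it. A limit of the
separating directions as `s` increases to `φ x` is a normal. -/
theorem exists_normal (h : IsGaussTransport R A φ ρ₀ ρ₁) (hx : x ∈ A) (hx0 : 0 < φ x) :
    ∃ θ ∈ Metric.sphere (0 : Euc d) 1, inner ℝ θ x = dualPotential A φ (φ x) θ := by
  have hxR := (h.data.mapsTo hx).2
  -- The shift by `2` keeps the level positive already at `n = 0`.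
  have hs : ∀ n : ℕ, φ x - φ x / (n + 2) ∈ Ioo 0 (φ x) := by
    intro n
    have : φ x / (n + 2) < φ x := div_lt_self hx0 (by linarith [n.cast_nonneg (α := ℝ)])
    exact ⟨by linarith, by linarith [div_pos hx0 (by positivity : (0 : ℝ) < n + 2)]⟩
  have hex : ∀ n : ℕ, ∃ θ ∈ Metric.sphere (0 : Euc d) 1,
      dualPotential A φ (φ x - φ x / (n + 2)) θ < inner ℝ θ x := fun n =>
    exists_dualPotential_lt h.data.isCompact h.data.continuousOn (h.data.convex_sublevel _)
      h.data.zero_mem (h.data.map_zero ▸ (hs n).1.le) fun hn => (hs n).2.not_ge hn.2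
  choose η hη hlt using hex
  obtain ⟨θ, hθ, k, hk, hlim⟩ := (isCompact_sphere (0 : Euc d) 1).tendsto_subseq hη
  refine ⟨θ, hθ, le_antisymm (inner_le_dualPotential h.data.isCompact θ hx le_rfl) ?_⟩
  have hsl : Tendsto (fun n : ℕ => φ x - φ x / (n + 2)) atTop (𝓝 (φ x)) := by
    have h1 : Tendsto (fun n : ℕ => φ x / ((n : ℝ) + 2)) atTop (𝓝 0) :=
      tendsto_const_nhds.div_atTop
        (tendsto_atTop_add_const_right _ _ tendsto_natCast_atTop_atTop)
    simpa using tendsto_const_nhds.sub h1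
  have hH := h.smooth.c1.continuousOn (φ x, θ) ⟨⟨hx0, hxR⟩, hθ⟩
  have hpair : Tendsto (fun n => (φ x - φ x / ((k n : ℝ) + 2), η (k n))) atTop
      (𝓝[Ioc 0 R ×ˢ Metric.sphere 0 1] (φ x, θ)) := by
    refine tendsto_nhdsWithin_iff.2 ⟨(hsl.comp hk.tendsto_atTop).prodMk_nhds hlim, ?_⟩
    exact Eventually.of_forall fun n =>
      ⟨⟨(hs (k n)).1, (hs (k n)).2.le.trans hxR⟩, hη (k n)⟩
  exact le_of_tendsto_of_tendsto (hH.tendsto.comp hpair)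
    (hlim.inner tendsto_const_nhds) (Eventually.of_forall fun n => (hlt (k n)).le)

end IsGaussTransport

/-- Strict differentiability in `r`, uniformly in `θ`. -/
theorem IsC1InRadius.eventually_norm_sub_le {V : Type*} [NormedAddCommGroup V] [NormedSpace ℝ V]
    {G : ℝ → Euc d → V} (hG : IsC1InRadius R G) (hr : r ∈ Ioc 0 R)
    (hθ : θ ∈ Metric.sphere (0 : Euc d) 1) {ε : ℝ} (hε : 0 < ε) :
    ∀ᶠ p : ℝ × Euc d in 𝓝[Ioc 0 R ×ˢ Metric.sphere 0 1] (r, θ),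
      ‖G p.1 p.2 - G r p.2 - (p.1 - r) • radialDeriv R G r θ‖ ≤ ε * |p.1 - r| := by
  have hc := hG.continuousOn_radialDeriv (r, θ) ⟨hr, hθ⟩
  have h1 := hc.tendsto.eventually (Metric.closedBall_mem_nhds _ hε)
  rw [nhdsWithin_prod_eq, Filter.eventually_prod_iff] at h1 ⊢
  obtain ⟨P, hP, Q, hQ, hPQ⟩ := h1
  obtain ⟨δ, hδ, hball⟩ := Metric.mem_nhdsWithin_iff.1 hP
  refine ⟨fun s => s ∈ Metric.ball r δ ∩ Ioc 0 R, inter_mem (mem_nhdsWithin_of_mem_nhds (Metric.ball_mem_nhds r hδ))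
    self_mem_nhdsWithin, fun η => Q η ∧
    η ∈ Metric.sphere (0 : Euc d) 1, hQ.and self_mem_nhdsWithin, ?_⟩
  intro s hs η hη
  have hcv : Convex ℝ (Metric.ball r δ ∩ Ioc 0 R) := (convex_ball r δ).inter (convex_Ioc 0 R)
  have := hcv.norm_image_sub_le_of_norm_hasDerivWithin_le
    (f := fun s => G s η - s • radialDeriv R G r θ)
    (f' := fun s => radialDeriv R G s η - radialDeriv R G r θ) (C := ε) (fun t ht => by
      have h2 := ((hG.hasDerivWithinAt ht.2 hη.2).mono inter_subset_right).sub
        ((hasDerivWithinAt_id t (Metric.ball r δ ∩ Ioc 0 R)).smul_const (radialDeriv R G r θ))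
      exact h2.congr_deriv (by simp)) (fun t ht => by simpa [dist_eq_norm] using hPQ (hball ht) hη.1)
      ⟨Metric.mem_ball_self hδ, hr⟩ hs
  refine le_trans (le_of_eq ?_) this
  congr 1
  rw [sub_smul]
  abel

namespace IsGaussTransport

theorem tendsto_inner_sub_dualPotential (h : IsGaussTransport R A φ ρ₀ ρ₁)
    (hx : x ∈ A) (hx0 : 0 < φ x) (hθ : θ ∈ Metric.sphere (0 : Euc d) 1) :
    Tendsto (fun p : Euc d × Euc d => inner ℝ p.2 p.1 - dualPotential A φ (φ p.1) p.2)
      (𝓝[A] x ×ˢ 𝓝[Metric.sphere 0 1] θ) (𝓝 (inner ℝ θ x - dualPotential A φ (φ x) θ)) := by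
  have hxR := (h.data.mapsTo hx).2
  have hφ : Tendsto φ (𝓝[A] x) (𝓝 (φ x)) := h.data.continuousOn x hx
  have hφ' : Tendsto φ (𝓝[A] x) (𝓝[Ioc 0 R] (φ x)) := by
    refine tendsto_nhdsWithin_iff.2 ⟨hφ, ?_⟩
    filter_upwards [hφ.eventually (lt_mem_nhds hx0), self_mem_nhdsWithin] with y hy hyA
    exact ⟨hy, (h.data.mapsTo hyA).2⟩
  have hid : Tendsto (fun y : Euc d => y) (𝓝[A] x) (𝓝 x) := nhdsWithin_le_nhds
  have hidθ : Tendsto (fun y : Euc d => y) (𝓝[Metric.sphere 0 1] θ) (𝓝 θ) := nhdsWithin_le_nhds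
  have hin : Tendsto (fun p : Euc d × Euc d => inner ℝ p.2 p.1)
      (𝓝[A] x ×ˢ 𝓝[Metric.sphere 0 1] θ) (𝓝 (inner ℝ θ x)) :=
    (hidθ.comp tendsto_snd).inner (hid.comp tendsto_fst)
  have hH : Tendsto (fun p : ℝ × Euc d => dualPotential A φ p.1 p.2)
      (𝓝[Ioc 0 R] (φ x) ×ˢ 𝓝[Metric.sphere 0 1] θ) (𝓝 (dualPotential A φ (φ x) θ)) := by
    rw [← nhdsWithin_prod_eq]
    exact h.smooth.c1.continuousOn (φ x, θ) ⟨⟨hx0, hxR⟩, hθ⟩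
  have hp : Tendsto (fun p : Euc d × Euc d => (φ p.1, p.2)) (𝓝[A] x ×ˢ 𝓝[Metric.sphere 0 1] θ)
      (𝓝[Ioc 0 R] (φ x) ×ˢ 𝓝[Metric.sphere 0 1] θ) :=
    (hφ'.comp tendsto_fst).prodMk tendsto_snd
  have hcomp := hH.comp hp
  exact Filter.Tendsto.sub (f := fun p : Euc d × Euc d => inner ℝ p.2 p.1)
    (g := fun p : Euc d × Euc d => dualPotential A φ (φ p.1) p.2) hin hcomp

theorem exists_hasFDerivWithinAt (h : IsGaussTransport R A φ ρ₀ ρ₁) (hd : 2 ≤ d)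
    (hx : x ∈ A) (hx0 : 0 < φ x) :
    ∃ θ ∈ Metric.sphere (0 : Euc d) 1, HasFDerivWithinAt φ
      ((radialDeriv R (dualPotential A φ) (φ x) θ)⁻¹ • innerSL ℝ θ) A x := by
  have hxr : φ x ∈ Ioc 0 R := ⟨hx0, (h.data.mapsTo hx).2⟩
  obtain ⟨θ, hθ, hθx⟩ := h.exists_normal hx hx0
  refine ⟨θ, hθ, ?_⟩
  have hφ : Tendsto φ (𝓝[A] x) (𝓝 (φ x)) := h.data.continuousOn x hx
  have hpos : ∀ᶠ y in 𝓝[A] x, 0 < φ y := hφ.eventually (lt_mem_nhds hx0)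
  have hφ' : Tendsto φ (𝓝[A] x) (𝓝[Ioc 0 R] (φ x)) := by
    refine tendsto_nhdsWithin_iff.2 ⟨hφ, ?_⟩
    filter_upwards [hpos, self_mem_nhdsWithin] with y hy hyA
    exact ⟨hy, (h.data.mapsTo hyA).2⟩
  have hex : ∀ y, ∃ η, y ∈ A → 0 < φ y → η ∈ Metric.sphere (0 : Euc d) 1 ∧
      inner ℝ η y = dualPotential A φ (φ y) η := by
    intro y
    by_cases hy : y ∈ A ∧ 0 < φ y
    · obtain ⟨η, hη, hηy⟩ := h.exists_normal hy.1 hy.2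
      exact ⟨η, fun _ _ => ⟨hη, hηy⟩⟩
    · exact ⟨0, fun h1 h2 => absurd ⟨h1, h2⟩ hy⟩
  choose N hN using hex
  have hNev : ∀ᶠ y in 𝓝[A] x, N y ∈ Metric.sphere (0 : Euc d) 1 ∧
      inner ℝ (N y) y = dualPotential A φ (φ y) (N y) := by
    filter_upwards [hpos, self_mem_nhdsWithin] with y hy hyA using hN y hyA hy
  -- The normals `N y` depend continuously on `y` at `x`: by closedness of the normality condition
  -- every cluster point is a normal at `x`, hence equals `θ`.
  have hNlim : Tendsto N (𝓝[A] x) (𝓝 θ) := by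
    refine (isCompact_sphere (0 : Euc d) 1).tendsto_nhds_of_unique_mapClusterPt
      (hNev.mono fun y hy => hy.1) fun η hη hcl => ?_
    refine h.normal_unique hd hxr hθ hη hx le_rfl hθx ?_
    by_contra hne
    have h1 := (h.tendsto_inner_sub_dualPotential hx hx0 hη).eventually
      (isOpen_ne.mem_nhds (sub_ne_zero.2 hne))
    obtain ⟨P, hP, Q, hQ, hPQ⟩ := Filter.eventually_prod_iff.1 h1
    rw [eventually_nhdsWithin_iff] at hQ
    obtain ⟨y, hQy, hPy, hy⟩ := ((hcl.frequently hQ).and_eventually (hP.and hNev)).exists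
    exact hPQ hPy (hQy hy.1) (sub_eq_zero.2 hy.2)
  set a := radialDeriv R (dualPotential A φ) (φ x) θ with ha
  have ha0 : 0 < a := (h.pos hd hxr hθ).2.1
  rw [hasFDerivWithinAt_iff_isLittleO, Asymptotics.isLittleO_iff]
  intro c hc
  -- The bound `a / 2` absorbs `ε |σ|` when `|σ|` is estimated by `4 / a * ‖y - x‖`; the last bound
  -- makes the final error at most `c * a * ‖y - x‖`.
  obtain ⟨ε, hε, hε1, hε2, hε3⟩ : ∃ ε : ℝ, 0 < ε ∧ ε ≤ a / 2 ∧ ε ≤ 1 ∧ ε * (1 + 4 / a) ≤ c * a := by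
    refine ⟨min (a / 2) (min 1 (c * a / (1 + 4 / a))), by positivity, min_le_left _ _,
      (min_le_right _ _).trans (min_le_left _ _), ?_⟩
    rw [← le_div_iff₀ (by positivity)]
    exact (min_le_right _ _).trans (min_le_right _ _)
  have hS := h.smooth.c1.eventually_norm_sub_le hxr hθ hε
  rw [nhdsWithin_prod_eq] at hS
  have hθlim : Tendsto (fun _ : Euc d => θ) (𝓝[A] x) (𝓝[Metric.sphere 0 1] θ) :=
    tendsto_nhdsWithin_iff.2 ⟨tendsto_const_nhds, Eventually.of_forall fun _ => hθ⟩
  have hNlim' : Tendsto N (𝓝[A] x) (𝓝[Metric.sphere 0 1] θ) :=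
    tendsto_nhdsWithin_iff.2 ⟨hNlim, hNev.mono fun y hy => hy.1⟩
  filter_upwards [(hφ'.prodMk hθlim).eventually hS, (hφ'.prodMk hNlim').eventually hS,
    hNlim.eventually (Metric.closedBall_mem_nhds θ hε), hNev, self_mem_nhdsWithin] with
    y h1 h2 h3 h4 hyA
  simp only [← ha, smul_eq_mul, Real.norm_eq_abs] at h1 h2
  have e1 : inner ℝ θ y ≤ dualPotential A φ (φ y) θ :=
    inner_le_dualPotential h.data.isCompact θ hyA le_rfl
  have e2 : inner ℝ (N y) x ≤ dualPotential A φ (φ x) (N y) :=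
    inner_le_dualPotential h.data.isCompact _ hx le_rfl
  have e3 : |inner ℝ (N y - θ) (y - x)| ≤ ε * ‖y - x‖ :=
    (abs_real_inner_le_norm _ _).trans (mul_le_mul_of_nonneg_right
      (by simpa [dist_eq_norm] using h3) (norm_nonneg _))
  have e4 : |inner ℝ θ (y - x)| ≤ ‖y - x‖ := by
    simpa [mem_sphere_zero_iff_norm.1 hθ] using abs_real_inner_le_norm θ (y - x)
  simp only [inner_sub_left, inner_sub_right] at e3 e4
  set σ := φ y - φ x with hσ
  set ip := inner ℝ θ y - inner ℝ θ x with hip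
  -- One side tests the normal `θ` of `x` at the point `y`; the other tests the normal `N y` of `y`
  -- at the point `x`. Each is linearized in the level by differentiability in `r`, uniformly near
  -- `θ`.
  have e5 : |σ * a - ip| ≤ ε * |σ| + ε * ‖y - x‖ := by
    rw [abs_le] at h1 h2 e3 ⊢
    constructor <;> nlinarith
  have e6 : |σ| ≤ 4 / a * ‖y - x‖ := by
    have : |σ| * a ≤ |σ * a - ip| + |ip| := by
      have := abs_add_le (σ * a - ip) ip
      rwa [sub_add_cancel, abs_mul, abs_of_pos ha0] at this
    rw [div_mul_eq_mul_div, le_div_iff₀ ha0]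
    nlinarith [abs_nonneg σ, norm_nonneg (y - x)]
  have e7 : |σ * a - ip| ≤ c * a * ‖y - x‖ := by
    calc |σ * a - ip| ≤ ε * |σ| + ε * ‖y - x‖ := e5
      _ ≤ ε * (4 / a * ‖y - x‖) + ε * ‖y - x‖ := by gcongr
      _ = ε * (1 + 4 / a) * ‖y - x‖ := by ring
      _ ≤ _ := by gcongr
  have e8 : φ y - φ x - (a⁻¹ • innerSL ℝ θ) (y - x) = a⁻¹ * (σ * a - ip) := by
    rw [smul_apply, innerSL_apply_apply, inner_sub_right, ← hip, ← hσ, smul_eq_mul]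
    field_simp
  rw [e8, Real.norm_eq_abs, abs_mul, abs_of_pos (inv_pos.2 ha0), inv_mul_le_iff₀ ha0]
  linarith

theorem interior_nonempty (h : IsGaussTransport R A φ ρ₀ ρ₁) (hd : 2 ≤ d) (hR : 0 < R) :
    (interior A).Nonempty :=
  ⟨0, h.mem_interior_of_lt hd (r := R / 2) ⟨half_pos hR, half_lt_self hR⟩ h.data.zero_mem
    (h.data.map_zero ▸ (half_pos hR).le)⟩

theorem exists_norm_gradientWithin_eq (h : IsGaussTransport R A φ ρ₀ ρ₁) (hd : 2 ≤ d)
    (hx : x ∈ A) (hx0 : 0 < φ x) :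
    DifferentiableWithinAt ℝ φ A x ∧ ∃ θ ∈ Metric.sphere (0 : Euc d) 1,
      ‖gradientWithin φ A x‖ = (radialDeriv R (dualPotential A φ) (φ x) θ)⁻¹ := by
  have hxr : φ x ∈ Ioc 0 R := ⟨hx0, (h.data.mapsTo hx).2⟩
  obtain ⟨θ, hθ, hder⟩ := h.exists_hasFDerivWithinAt hd hx hx0
  refine ⟨hder.differentiableWithinAt, θ, hθ, ?_⟩
  have hu : UniqueDiffWithinAt ℝ A x := uniqueDiffWithinAt_convex h.data.convex
    (h.interior_nonempty hd (hxr.1.trans_le hxr.2)) (subset_closure hx)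
  rw [gradientWithin, hder.fderivWithin hu, LinearIsometryEquiv.norm_map, norm_smul,
    innerSL_apply_norm, mem_sphere_zero_iff_norm.1 hθ, mul_one,
    Real.norm_of_nonneg (inv_nonneg.2 (h.pos hd hxr hθ).2.1.le)]

end IsGaussTransport

/-! ### The Gauss curvature of the boundary. -/

theorem eventually_lt_of_fderiv_neg (hψ : DifferentiableAt ℝ ψ x) (hv : fderiv ℝ ψ x v < 0) :
    ∀ᶠ t in 𝓝[>] (0 : ℝ), ψ (x + t • v) < ψ x := by
  have h1 : HasDerivAt (fun t : ℝ => x + t • v) v 0 := by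
    simpa using ((hasDerivAt_id (0 : ℝ)).smul_const v).const_add x
  have h2 := HasFDerivAt.comp_hasDerivAt_of_eq (0 : ℝ) hψ.hasFDerivAt h1 (by simp)
  have h3 := (hasDerivAt_iff_tendsto_slope.1 h2).eventually (gt_mem_nhds hv)
  filter_upwards [h3.filter_mono (nhdsWithin_mono _ fun t ht => ne_of_gt ht),
    self_mem_nhdsWithin] with t ht ht0
  have ht0' : (0 : ℝ) < t := ht0
  simp only [slope_def_field, Function.comp_apply, zero_smul, add_zero, sub_zero] at ht
  have := (div_neg_iff.1 ht).resolve_left fun h => ht0'.not_gt h.2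
  linarith [this.1]

/-- At a boundary point with outer normal `θ` the gradient of a defining function is a positive
multiple of `θ`. -/
theorem gradient_eq_norm_smul (hψ : DifferentiableAt ℝ ψ x)
    (hmem : ∀ᶠ y in 𝓝 x, ψ y ≤ 0 → y ∈ A) (hx : ψ x ≤ 0)
    (hθ : θ ∈ Metric.sphere (0 : Euc d) 1) (hmax : ∀ y ∈ A, inner ℝ θ y ≤ inner ℝ θ x)
    (hne : gradient ψ x ≠ 0) : gradient ψ x = ‖gradient ψ x‖ • θ := by
  set n := gradient ψ x with hn
  have hn0 : 0 < ‖n‖ := norm_pos_iff.2 hne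
  -- Directions that decrease `ψ` point into `A`, where `⟨θ, ·⟩` is maximal at `x`. If `n` were not
  -- `‖n‖ • θ`, the direction `‖n‖ • θ - n` would decrease `ψ` and increase `⟨θ, ·⟩`.
  have key : ∀ w : Euc d, inner ℝ n w < 0 → inner ℝ θ w ≤ 0 := by
    intro w hw
    rw [hn, inner_gradient_eq_fderiv] at hw
    have ht : Tendsto (fun t : ℝ => x + t • w) (𝓝[>] 0) (𝓝 x) := by
      have : Continuous fun t : ℝ => x + t • w := by fun_prop
      simpa using (this.tendsto 0).mono_left nhdsWithin_le_nhds
    obtain ⟨t, ⟨h1, h2⟩, h3⟩ := (((eventually_lt_of_fderiv_neg hψ hw).and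
      (ht.eventually hmem)).and self_mem_nhdsWithin).exists
    have h4 := hmax _ (h2 (h1.le.trans hx))
    rw [inner_add_right, real_inner_smul_right] at h4
    have h3' : (0 : ℝ) < t := h3
    by_contra! h5
    nlinarith [mul_pos h3' h5]
  set c := inner ℝ n θ with hc
  have hcn : c ≤ ‖n‖ := by
    simpa [mem_sphere_zero_iff_norm.1 hθ] using real_inner_le_norm n θ
  have hθθ : inner ℝ θ θ = (1 : ℝ) := by
    rw [real_inner_self_eq_norm_sq, mem_sphere_zero_iff_norm.1 hθ, one_pow]
  by_contra hne'
  have hlt : c < ‖n‖ := by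
    refine lt_of_le_of_ne hcn fun h => hne' ?_
    have h1 := (inner_eq_norm_mul_iff_real (x := n) (y := θ)).1
      (by rw [← hc, h, mem_sphere_zero_iff_norm.1 hθ, mul_one])
    rw [mem_sphere_zero_iff_norm.1 hθ, one_smul] at h1
    exact h1
  have h1 := key (‖n‖ • θ - n) (by
    rw [inner_sub_right, real_inner_smul_right, real_inner_self_eq_norm_sq, ← hc]
    nlinarith)
  rw [inner_sub_right, real_inner_smul_right, hθθ, real_inner_comm, ← hc] at h1
  linarith

theorem det_compress_smul (L : Euc d →L[ℝ] Euc d) (n : Euc d) {c : ℝ} (hc : c ≠ 0) :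
    (compress L (c • n)).det = (compress L n).det := by
  have hspan : (ℝ ∙ (c • n))ᗮ = (ℝ ∙ n)ᗮ := by
    rw [Submodule.span_singleton_smul_eq hc.isUnit]
  -- The two determinants live on different types, so the equality of subspaces is substituted for a
  -- variable subspace.
  have key : ∀ K₁ K₂ : Submodule ℝ (Euc d), K₁ = K₂ →
      (K₁.orthogonalProjectionOnto ∘L L ∘L K₁.subtypeL).det
        = (K₂.orthogonalProjectionOnto ∘L L ∘L K₂.subtypeL).det := by
    rintro K₁ _ rfl
    rfl
  exact key _ _ hspan

theorem gradient_inverseTransport_eq {H : ℝ → Euc d → ℝ}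
    (hψ : IsDefiningFunctionAt A (inverseTransport H R θ) ψ)
    (hF : ContDiffOn ℝ 2 (radialExt (H R)) {0}ᶜ)
    (hmem : ∀ η ∈ Metric.sphere (0 : Euc d) 1, inverseTransport H R η ∈ A)
    (hmax : ∀ η ∈ Metric.sphere (0 : Euc d) 1, ∀ y ∈ A,
      inner ℝ η y ≤ inner ℝ η (inverseTransport H R η))
    (hθ : θ ∈ Metric.sphere (0 : Euc d) 1) (hv : v ∈ Metric.sphere (0 : Euc d) 1)
    (hθv : inner ℝ θ v = 0) :
    ∀ᶠ t in 𝓝 (0 : ℝ), gradient ψ (inverseTransport H R (greatCircle θ v t))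
      = ‖gradient ψ (inverseTransport H R (greatCircle θ v t))‖ • greatCircle θ v t := by
  have hT : Tendsto (fun t => inverseTransport H R (greatCircle θ v t)) (𝓝 0)
      (𝓝 (inverseTransport H R θ)) := by
    simpa using (hasDerivAt_inverseTransport_greatCircle hF hθ hv hθv).continuousAt.tendsto
  have hg : ∀ᶠ z in 𝓝 (inverseTransport H R θ), gradient ψ z ≠ 0 :=
    hψ.contDiffAt.differentiableAt_gradient.continuousAt.eventually_ne hψ.gradient_ne_zero
  have hdiff : ∀ᶠ z in 𝓝 (inverseTransport H R θ), DifferentiableAt ℝ ψ z :=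
    (hψ.contDiffAt.eventually (by simp)).mono fun z hz => hz.differentiableAt two_ne_zero
  filter_upwards [hT.eventually hg, hT.eventually hdiff,
    hT.eventually hψ.mem_iff.eventually_nhds] with t h1 h2 h3
  have hm := greatCircle_mem_sphere hθ hv hθv t
  exact gradient_eq_norm_smul h2 (h3.mono fun y hy => hy.2)
    (h3.self_of_nhds.1 (hmem _ hm)) hm (hmax _ hm) h1

/-- Differentiating `∇ψ(T⁻¹η) = |∇ψ| η` in `η` and projecting to `θ^⊥` shows that the shape operator
is inverse to `H Id + D²H`. The argument works for any defining function, hence for the one chosen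
in `gaussCurvature`. -/
theorem levelSetCurvature_mul_curvatureDet {H : ℝ → Euc d → ℝ} (hd : 2 ≤ d)
    (hψ : IsDefiningFunctionAt A (inverseTransport H R θ) ψ)
    (hF : ContDiffOn ℝ 2 (radialExt (H R)) {0}ᶜ)
    (hmem : ∀ η ∈ Metric.sphere (0 : Euc d) 1, inverseTransport H R η ∈ A)
    (hmax : ∀ η ∈ Metric.sphere (0 : Euc d) 1, ∀ y ∈ A,
      inner ℝ η y ≤ inner ℝ η (inverseTransport H R η))
    (hθ : θ ∈ Metric.sphere (0 : Euc d) 1) :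
    levelSetCurvature ψ (inverseTransport H R θ) * curvatureDet H R θ = 1 := by
  set x := inverseTransport H R θ with hx
  have hn0 : 0 < ‖gradient ψ x‖ := norm_pos_iff.2 hψ.gradient_ne_zero
  have hW : ∀ v : Euc d, v ∈ (ℝ ∙ θ)ᗮ ↔ inner ℝ θ v = 0 := fun v =>
    Submodule.mem_orthogonal_singleton_iff_inner_right
  obtain ⟨v₀, hv₀, hθv₀⟩ : ∃ v ∈ Metric.sphere (0 : Euc d) 1, inner ℝ θ v = 0 := by
    have : Nontrivial (ℝ ∙ θ)ᗮ := Module.nontrivial_of_finrank_pos (R := ℝ) (by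
      rw [finrank_orthogonal_of_mem_sphere hd hθ]; omega)
    obtain ⟨w, hw⟩ := exists_norm_eq (ℝ ∙ θ)ᗮ (zero_le_one (α := ℝ))
    exact ⟨w, by simpa using hw, (hW _).1 w.2⟩
  have hgx : gradient ψ x = ‖gradient ψ x‖ • θ := by
    have := (gradient_inverseTransport_eq hψ hF hmem hmax hθ hv₀ hθv₀).self_of_nhds
    simpa only [greatCircle_zero] using this
  have hder : ∀ v ∈ Metric.sphere (0 : Euc d) 1, inner ℝ θ v = 0 → ∀ w, inner ℝ θ w = 0 →
      inner ℝ (fderiv ℝ (gradient ψ) x (H R θ • v + sphHessExt (H R) θ v)) w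
        = ‖gradient ψ x‖ * inner ℝ v w := by
    intro v hv hθv w hθw
    have hG : HasDerivAt (fun t => gradient ψ (inverseTransport H R (greatCircle θ v t)))
        (fderiv ℝ (gradient ψ) x (H R θ • v + sphHessExt (H R) θ v)) 0 :=
      HasFDerivAt.comp_hasDerivAt_of_eq (0 : ℝ) hψ.contDiffAt.differentiableAt_gradient.hasFDerivAt
        (hasDerivAt_inverseTransport_greatCircle hF hθ hv hθv) (by simp [hx])
    have h1 := hG.inner ℝ (hasDerivAt_const (0 : ℝ) w)
    -- The length `|∇ψ|` is written as `⟨∇ψ, γ⟩` with `γ` the great circle. Its derivative drops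
    -- out, being multiplied by `⟨θ, w⟩ = 0`.
    have h2 := (hG.inner ℝ (hasDerivAt_greatCircle θ v 0)).mul
      ((hasDerivAt_greatCircle θ v 0).inner ℝ (hasDerivAt_const (0 : ℝ) w))
    have h3 : HasDerivAt (fun t => inner ℝ
        (gradient ψ (inverseTransport H R (greatCircle θ v t))) w) _ 0 :=
      h2.congr_of_eventuallyEq (by
        filter_upwards [gradient_inverseTransport_eq hψ hF hmem hmax hθ hv hθv] with t ht
        have hm := greatCircle_mem_sphere hθ hv hθv t
        rw [Pi.mul_apply]
        nth_rewrite 1 [ht]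
        nth_rewrite 2 [ht]
        rw [real_inner_smul_left, real_inner_smul_left, real_inner_self_eq_norm_sq,
          mem_sphere_zero_iff_norm.1 hm]
        ring)
    have h4 := h1.unique h3
    have h5 : inner ℝ (gradient ψ x) θ = ‖gradient ψ x‖ := by
      nth_rewrite 1 [hgx]
      rw [real_inner_smul_left, real_inner_self_eq_norm_sq, mem_sphere_zero_iff_norm.1 hθ]
      ring
    simpa [hθw, ← hx, h5] using h4
  have hcomp : compress (‖gradient ψ x‖⁻¹ • fderiv ℝ (gradient ψ) x) θ ∘L
      (H R θ • ContinuousLinearMap.id ℝ (ℝ ∙ θ)ᗮ + sphHess (H R) θ)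
        = ContinuousLinearMap.id ℝ (ℝ ∙ θ)ᗮ := by
    have hunit : ∀ v w : (ℝ ∙ θ)ᗮ, ‖v‖ = 1 → inner ℝ
        (compress (‖gradient ψ x‖⁻¹ • fderiv ℝ (gradient ψ) x) θ
          ((H R θ • ContinuousLinearMap.id ℝ (ℝ ∙ θ)ᗮ + sphHess (H R) θ) v)) w
        = inner ℝ v w := by
      intro v w hv
      have h1 := hder v (by simpa using hv) ((hW _).1 v.2) w ((hW _).1 w.2)
      rw [sphHessExt_apply] at h1
      rw [inner_compress, smul_apply, real_inner_smul_left, inv_mul_eq_iff_eq_mul₀ hn0.ne',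
        Submodule.coe_inner]
      exact h1
    refine ContinuousLinearMap.ext fun v => ext_inner_right ℝ fun w => ?_
    by_cases hv : v = 0
    · simp [hv]
    have hv' : ‖v‖ ≠ 0 := norm_ne_zero_iff.2 hv
    have h1 := hunit (‖v‖⁻¹ • v) w (by rw [norm_smul, norm_inv, norm_norm, inv_mul_cancel₀ hv'])
    rw [map_smul, map_smul, real_inner_smul_left, real_inner_smul_left] at h1
    exact mul_left_cancel₀ (inv_ne_zero hv') h1
  have hdet := congrArg ContinuousLinearMap.det hcomp
  rw [levelSetCurvature, hgx, norm_smul, norm_norm, mem_sphere_zero_iff_norm.1 hθ, mul_one,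
    det_compress_smul _ _ hn0.ne', curvatureDet]
  simp only [ContinuousLinearMap.det, ContinuousLinearMap.coe_id, LinearMap.det_id] at hdet ⊢
  exact (LinearMap.det_comp _ _).symm.trans hdet

namespace IsGaussTransport

theorem gaussCurvature_mul_curvatureDet (h : IsGaussTransport R A φ ρ₀ ρ₁) (hd : 2 ≤ d)
    (hR : 0 < R) (hA : HasC2Boundary A) (hθ : θ ∈ Metric.sphere (0 : Euc d) 1) :
    inverseTransport (dualPotential A φ) R θ ∈ frontier A ∧
    gaussCurvature A (inverseTransport (dualPotential A φ) R θ)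
      * curvatureDet (dualPotential A φ) R θ = 1 := by
  have hR' : R ∈ Ioc 0 R := ⟨hR, le_rfl⟩
  have hmem : ∀ η ∈ Metric.sphere (0 : Euc d) 1,
      inverseTransport (dualPotential A φ) R η ∈ A := fun η hη => (h.inverseTransport_spec hR' hη).1
  have hmax : ∀ η ∈ Metric.sphere (0 : Euc d) 1, ∀ y ∈ A,
      inner ℝ η y ≤ inner ℝ η (inverseTransport (dualPotential A φ) R η) := by
    intro η hη y hy
    rw [(h.inverseTransport_spec hR' hη).2.2]
    exact inner_le_dualPotential h.data.isCompact η hy (h.data.mapsTo hy).2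
  have hfr : inverseTransport (dualPotential A φ) R θ ∈ frontier A := by
    refine ⟨subset_closure (hmem θ hθ), fun hint => ?_⟩
    set x := inverseTransport (dualPotential A φ) R θ
    have ht : Tendsto (fun t : ℝ => x + t • θ) (𝓝[>] 0) (𝓝 x) := by
      have : Continuous fun t : ℝ => x + t • θ := by fun_prop
      simpa using (this.tendsto 0).mono_left nhdsWithin_le_nhds
    obtain ⟨t, h1, h2⟩ := ((ht.eventually (mem_interior_iff_mem_nhds.1 hint)).and
      self_mem_nhdsWithin).exists
    have h3 := hmax θ hθ _ h1
    rw [inner_add_right, real_inner_smul_right, real_inner_self_eq_norm_sq,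
      mem_sphere_zero_iff_norm.1 hθ] at h3
    have h4 : (0 : ℝ) < t := h2
    linarith
  refine ⟨hfr, ?_⟩
  have hex := hA _ hfr
  rw [gaussCurvature, dif_pos hex]
  exact levelSetCurvature_mul_curvatureDet hd hex.choose_spec (h.smooth.contDiffOn R hR') hmem
    hmax hθ

end IsGaussTransport

/-! ### Part (b): the upper bound by a maximum principle. -/

/-- At a tangency point of the radial derivative with an affine function of the potential from
below, the radial derivatives of the gradient and of the Hessian are controlled. -/
theorem IsSmoothPotential.tangency {H : ℝ → Euc d → ℝ} (hH : IsSmoothPotential R H)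
    (hr : r ∈ Ioo 0 R) (hθ : θ ∈ Metric.sphere (0 : Euc d) 1) {q c : ℝ}
    (hmax : ∀ η ∈ Metric.sphere (0 : Euc d) 1, radialDeriv R H r η ≤ q * (H r η - c))
    (heq : radialDeriv R H r θ = q * (H r θ - c))
    (hv : v ∈ Metric.sphere (0 : Euc d) 1) (hθv : inner ℝ θ v = 0) :
    inner ℝ (radialDeriv R (fun r => sphGrad (H r)) r θ) v = q * inner ℝ (sphGrad (H r) θ) v ∧
    inner ℝ (radialDeriv R (fun r => sphHessExt (H r)) r θ v) v
      ≤ q * inner ℝ (sphHessExt (H r) θ v) v := by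
  have hF := hH.contDiffOn r (Ioo_subset_Ioc_self hr)
  have h1 : ∀ t, HasDerivAt (fun t => q * (H r (greatCircle θ v t) - c)
      - radialDeriv R H r (greatCircle θ v t))
      (q * inner ℝ (sphGrad (H r) (greatCircle θ v t)) (greatCircleVel θ v t)
        - inner ℝ (radialDeriv R (fun r => sphGrad (H r)) r (greatCircle θ v t))
        (greatCircleVel θ v t)) t := fun t =>
    (((hasDerivAt_greatCircle_comp hF hθ hv hθv t).sub_const c).const_mul q).sub
      (hH.hasDerivAt_radialDeriv_greatCircle hr hθ hv hθv t)
  have h2 := ((hasDerivAt_inner_sphGrad_greatCircle hF hθ hv hθv 0).const_mul q).sub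
    (hH.hasDerivAt_inner_radialDeriv_sphGrad_greatCircle hr hθ hv hθv 0)
  have hmin : IsLocalMin (fun t => q * (H r (greatCircle θ v t) - c)
      - radialDeriv R H r (greatCircle θ v t)) 0 := by
    refine Eventually.of_forall fun t => ?_
    have := hmax _ (greatCircle_mem_sphere hθ hv hθv t)
    simp only [greatCircle_zero, heq, sub_self]
    linarith
  have e1 := hmin.hasDerivAt_eq_zero (h1 0)
  have e2 := second_deriv_nonneg_of_isLocalMin (Eventually.of_forall h1) h2 hmin
  simp only [greatCircle_zero, greatCircleVel_zero] at e1 e2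
  exact ⟨by linarith, by linarith⟩

theorem IsSmoothPotential.inner_radialDeriv_sphGrad_self {H : ℝ → Euc d → ℝ}
    (hH : IsSmoothPotential R H) (hr : r ∈ Ioo 0 R) (hθ : θ ∈ Metric.sphere (0 : Euc d) 1) :
    inner ℝ (radialDeriv R (fun r => sphGrad (H r)) r θ) θ = 0 := by
  have h1 := (hH.c1_sphGrad.hasDerivAt hr hθ).inner ℝ (hasDerivAt_const r θ)
  have h2 : HasDerivAt (fun s => inner ℝ (sphGrad (H s) θ) θ) 0 r := by
    refine (hasDerivAt_const r (0 : ℝ)).congr_of_eventuallyEq ?_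
    filter_upwards [isOpen_Ioo.mem_nhds hr] with s hs
    exact inner_sphGrad_self (hH.contDiffOn s (Ioo_subset_Ioc_self hs)) hθ
  simpa using h1.unique h2

theorem IsSmoothPotential.radialDeriv_sphGrad_eq {H : ℝ → Euc d → ℝ} (hH : IsSmoothPotential R H)
    (hr : r ∈ Ioo 0 R) (hθ : θ ∈ Metric.sphere (0 : Euc d) 1) {q c : ℝ}
    (hmax : ∀ η ∈ Metric.sphere (0 : Euc d) 1, radialDeriv R H r η ≤ q * (H r η - c))
    (heq : radialDeriv R H r θ = q * (H r θ - c)) :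
    radialDeriv R (fun r => sphGrad (H r)) r θ = q • sphGrad (H r) θ := by
  refine eq_of_inner_eq_of_forall_orthogonal (θ := θ) ?_ fun v hv hθv => ?_
  · rw [real_inner_comm, hH.inner_radialDeriv_sphGrad_self hr hθ, real_inner_smul_right,
      real_inner_comm, inner_sphGrad_self (hH.contDiffOn r (Ioo_subset_Ioc_self hr)) hθ, mul_zero]
  · rw [real_inner_comm, (hH.tangency hr hθ hmax heq hv hθv).1, real_inner_smul_right,
      real_inner_comm]

theorem coe_mem_sphere_of_orthonormalBasis {ι : Type*} [Fintype ι]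
    (b : OrthonormalBasis ι ℝ (ℝ ∙ θ)ᗮ) (i : ι) :
    (b i : Euc d) ∈ Metric.sphere (0 : Euc d) 1 ∧ inner ℝ θ (b i : Euc d) = 0 := by
  refine ⟨?_, Submodule.mem_orthogonal_singleton_iff_inner_right.1 (b i).2⟩
  rw [mem_sphere_zero_iff_norm]
  exact b.norm_eq_one i

namespace IsGaussTransport

/-- The upper bound of the radial derivative at an interior maximum point. -/
theorem mul_rpow_le_of_tangency (h : IsGaussTransport R A φ ρ₀ ρ₁) (hd : 2 ≤ d)
    (hr : r ∈ Ioo 0 R) (hθ : θ ∈ Metric.sphere (0 : Euc d) 1) {C D q c : ℝ}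
    (hC : 0 < C) (hc : 0 ≤ c) (hq : 0 < q)
    (hmax : ∀ η ∈ Metric.sphere (0 : Euc d) 1,
      radialDeriv R (dualPotential A φ) r η ≤ q * (dualPotential A φ r η - c))
    (heq : radialDeriv R (dualPotential A φ) r θ = q * (dualPotential A φ r θ - c))
    (hrr : radialDeriv R (radialDeriv R (dualPotential A φ)) r θ
      ≤ (q - (C + 1)) * radialDeriv R (dualPotential A φ) r θ)
    (hgrad : ∀ x ∈ interior A, ‖gradient ρ₀ x‖ / ρ₀ x ≤ C) (hρ : ∀ x ∈ A, 1 / C ≤ ρ₀ x)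
    (hP : polarDensity ρ₁ r θ ≤ C)
    (hP' : -C ≤ deriv (fun s => polarDensity ρ₁ s θ) r / polarDensity ρ₁ r θ)
    (hD : ∀ x ∈ A, ‖x‖ ≤ D) :
    c * (radialDeriv R (dualPotential A φ) r θ / C ^ 2) ^ (1 / ((d - 1 : ℕ) : ℝ))
      ≤ C * (D + c) + d := by
  have hr' := Ioo_subset_Ioc_self hr
  obtain ⟨b, μ, hμ, hdet, hμeq, hlog⟩ := h.logDeriv_polarDensity hd hr hθ
  obtain ⟨hp1, hp2, hp3⟩ := h.pos hd hr' hθ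
  have hsol := h.solves r hr' θ hθ
  have hG := h.smooth.radialDeriv_sphGrad_eq hr hθ hmax heq
  have htan := fun i => (h.smooth.tangency hr hθ hmax heq
    (coe_mem_sphere_of_orthonormalBasis b i).1 (coe_mem_sphere_of_orthonormalBasis b i).2).2
  have hxA := (h.inverseTransport_spec hr' hθ).1
  have hxint := h.inverseTransport_mem_interior hd hr hθ
  -- By tangency `(T⁻¹)_r = q (T⁻¹ - cθ)`, so the gradient term is proportional to `q`, and the
  -- factor `q` can be cancelled at the end.
  have hx : radialDeriv R (dualPotential A φ) r θ • θ
      + radialDeriv R (fun r => sphGrad (dualPotential A φ r)) r θ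
      = q • (inverseTransport (dualPotential A φ) r θ - c • θ) := by
    rw [hG, heq, inverseTransport]
    module
  rw [hx] at hlog
  set x := inverseTransport (dualPotential A φ) r θ with hxdef
  set p := radialDeriv R (dualPotential A φ) r θ with hpdef
  set n : ℝ := ((d - 1 : ℕ) : ℝ) with hn
  have hn1 : (1 : ℝ) ≤ n := by rw [hn]; exact_mod_cast (by omega : 1 ≤ d - 1)
  have hnd : n + 1 = d := by rw [hn]; exact_mod_cast (by omega : d - 1 + 1 = d)
  have t1 : inner ℝ (gradient ρ₀ x) (q • (x - c • θ)) / ρ₀ x ≤ q * (C * (D + c)) := by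
    have hnx : ‖x - c • θ‖ ≤ D + c := by
      refine (norm_sub_le _ _).trans (add_le_add (hD x hxA) ?_)
      rw [norm_smul, mem_sphere_zero_iff_norm.1 hθ, mul_one, Real.norm_of_nonneg hc]
    have hg : ‖gradient ρ₀ x‖ ≤ C * ρ₀ x := (div_le_iff₀ hp1).1 (hgrad x hxint)
    rw [div_le_iff₀ hp1, real_inner_smul_right]
    calc q * inner ℝ (gradient ρ₀ x) (x - c • θ)
        ≤ q * (‖gradient ρ₀ x‖ * ‖x - c • θ‖) := by
          gcongr; exact real_inner_le_norm _ _
      _ ≤ q * ((C * ρ₀ x) * (D + c)) := by gcongr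
      _ = _ := by ring
  have t2 : radialDeriv R (radialDeriv R (dualPotential A φ)) r θ / p ≤ q - (C + 1) :=
    (div_le_iff₀ hp2).2 hrr
  have t3 : ∑ i, (p + inner ℝ (radialDeriv R (fun r => sphHessExt (dualPotential A φ r)) r θ (b i))
      (b i : Euc d)) / μ i ≤ q * n - q * c * ∑ i, (μ i)⁻¹ := by
    have hi : ∀ i, (p + inner ℝ
        (radialDeriv R (fun r => sphHessExt (dualPotential A φ r)) r θ (b i)) (b i : Euc d)) / μ i
        ≤ q - q * c * (μ i)⁻¹ := by
      intro i
      rw [div_le_iff₀ (hμ i), sub_mul, mul_assoc, inv_mul_cancel₀ (hμ i).ne']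
      have e1 := htan i
      have e2 := hμeq i
      rw [heq]
      nlinarith
    refine (Finset.sum_le_sum fun i _ => hi i).trans (le_of_eq ?_)
    rw [Finset.sum_sub_distrib, ← Finset.mul_sum]
    simp [hn, mul_comm]
  have hsum : (p / C ^ 2) ^ (1 / n) ≤ ∑ i, (μ i)⁻¹ := by
    have h1 := card_mul_inv_prod_rpow_le_sum_inv (by omega : 0 < d - 1) hμ
    have h2 : p / C ^ 2 ≤ (∏ i, μ i)⁻¹ := by
      rw [← hdet, ← one_div, div_le_div_iff₀ (by positivity) hp3, one_mul]
      have h3 : 1 / C * (p * curvatureDet (dualPotential A φ) r θ) ≤ C := by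
        refine le_trans ?_ hP
        rw [hsol, mul_assoc]
        exact mul_le_mul_of_nonneg_right (hρ x hxA) (by positivity)
      rw [one_div, inv_mul_le_iff₀ hC] at h3
      linarith
    have h3 : (p / C ^ 2) ^ (1 / n) ≤ (∏ i, μ i)⁻¹ ^ (1 / n) :=
      Real.rpow_le_rpow (by positivity) h2 (by positivity)
    refine h3.trans (le_trans ?_ h1)
    exact le_mul_of_one_le_left (Real.rpow_nonneg (inv_nonneg.2
      (Finset.prod_nonneg fun i _ => (hμ i).le)) _) hn1
  -- The `-(C + 1)` in the bound for `H_rr / H_r` outweighs the lower bound `-C` of `P_r / P`,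
  -- leaving only terms proportional to `q`.
  have hall : q * (c * ∑ i, (μ i)⁻¹) ≤ q * (C * (D + c) + d) := by
    rw [hlog] at hP'
    rw [← hnd]
    linarith
  refine le_trans (mul_le_mul_of_nonneg_left hsum hc) (le_of_mul_le_mul_left hall hq)

end IsGaussTransport

/-- Only points to the right of `a` are compared, because the maximum over `[r₀, R]` may be attained
at `r₀`. -/
theorem hasDerivAt_nonpos_of_forall_le {f : ℝ → ℝ} {f' a b : ℝ} (hab : a < b)
    (hf : HasDerivAt f f' a) (hle : ∀ s ∈ Ioo a b, f s ≤ f a) : f' ≤ 0 := by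
  have h1 := (hasDerivAt_iff_tendsto_slope.1 hf).mono_left
    (nhdsWithin_mono a (fun t (ht : t ∈ Ioi a) => ne_of_gt ht))
  refine le_of_tendsto h1 ?_
  filter_upwards [Ioo_mem_nhdsGT hab] with s hs
  rw [slope_def_field]
  exact div_nonpos_of_nonpos_of_nonneg (sub_nonpos.2 (hle s hs)) (sub_nonneg.2 hs.1.le)

namespace IsGaussTransport

/-- The equation at `r = R` with the determinant replaced by `1 / K`; this provides the boundary
values of `H_r` in both parts. -/
theorem radialDeriv_boundary (h : IsGaussTransport R A φ ρ₀ ρ₁) (hd : 2 ≤ d)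
    (hR : 0 < R) (hA : HasC2Boundary A) (hθ : θ ∈ Metric.sphere (0 : Euc d) 1) :
    ∃ x ∈ frontier A, x ∈ A ∧ 0 < ρ₀ x ∧ 0 < gaussCurvature A x ∧
      radialDeriv R (dualPotential A φ) R θ
        = polarDensity ρ₁ R θ * gaussCurvature A x / ρ₀ x := by
  have hR' : R ∈ Ioc 0 R := ⟨hR, le_rfl⟩
  obtain ⟨h1, h2⟩ := h.gaussCurvature_mul_curvatureDet hd hR hA hθ
  obtain ⟨hp1, hp2, hp3⟩ := h.pos hd hR' hθ
  have hK : gaussCurvature A (inverseTransport (dualPotential A φ) R θ)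
      = (curvatureDet (dualPotential A φ) R θ)⁻¹ := eq_inv_of_mul_eq_one_left h2
  refine ⟨_, h1, (h.inverseTransport_spec hR' hθ).1, hp1, ?_, ?_⟩
  · rw [hK]
    positivity
  · rw [hK, h.solves R hR' θ hθ]
    field_simp

theorem volume_le (h : IsGaussTransport R A φ ρ₀ ρ₁) {C : ℝ} (hC : 0 < C)
    (hρ : ∀ x ∈ A, 1 / C ≤ ρ₀ x) : (volume A).toReal ≤ C := by
  have hint : IntegrableOn ρ₀ A := by
    -- A nonintegrable function has integral `0` by convention, which is incompatible with total
    -- mass `1`.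
    by_contra hn
    have := h.data.source_integral
    rw [integral_undef hn] at this
    exact zero_ne_one this
  have h1 : ∫ _ in A, 1 / C ≤ ∫ x in A, ρ₀ x :=
    setIntegral_mono_on (integrableOn_const h.data.isCompact.measure_lt_top.ne) hint
      h.data.isCompact.measurableSet hρ
  rw [h.data.source_integral, setIntegral_const, smul_eq_mul, Measure.real, mul_one_div,
    div_le_one hC] at h1
  exact h1

end IsGaussTransport

/-- A convex body that contains a ball is bounded in terms of its volume. -/
theorem norm_le_of_volume_le (hA : Convex ℝ A) (hfin : volume A ≠ ⊤) {C δ : ℝ} (hδ : 0 < δ)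
    (hvol : (volume A).toReal ≤ C) (hball : Metric.ball 0 δ ⊆ A) (hx : x ∈ A) :
    ‖x‖ ≤ 2 * δ * (C / (volume (Metric.ball (0 : Euc d) (δ / 2))).toReal) := by
  set V := volume (Metric.ball (0 : Euc d) (δ / 2)) with hV
  have hC : 0 ≤ C := ENNReal.toReal_nonneg.trans hvol
  by_cases hx0 : x = 0
  · rw [hx0, norm_zero]
    positivity
  have hxn : 0 < ‖x‖ := norm_pos_iff.2 hx0
  have hVpos : 0 < V.toReal := ENNReal.toReal_pos
    (Metric.measure_ball_pos _ _ (half_pos hδ)).ne' measure_ball_lt_top.ne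
  -- Points spaced by `δ` on the half of the segment from `0` to `x` nearer to `0`, counting `k =
  -- 0`. By convexity the balls of radius `δ / 2` about them lie in `A`; they are disjoint, so their
  -- number is bounded by the volume.
  set N := ⌊‖x‖ / (2 * δ)⌋₊ + 1 with hN
  set t : ℕ → ℝ := fun k => k * δ / ‖x‖ with ht
  have ht0 : ∀ k, 0 ≤ t k := fun k => by positivity
  have ht1 : ∀ k ∈ Finset.range N, t k ≤ 1 / 2 := by
    intro k hk
    have hk' : k ≤ ⌊‖x‖ / (2 * δ)⌋₊ := Nat.lt_succ_iff.1 (Finset.mem_range.1 hk)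
    have h2 := (Nat.le_floor_iff (by positivity)).1 hk'
    rw [le_div_iff₀ (by positivity)] at h2
    rw [ht, div_le_iff₀ hxn]
    linarith
  have hsub : (⋃ k ∈ Finset.range N, Metric.ball (t k • x) (δ / 2)) ⊆ A := by
    refine iUnion₂_subset fun k hk z hz => ?_
    have h1 : 0 < 1 - t k := by linarith [ht1 k hk]
    have hz' : (1 - t k)⁻¹ • (z - t k • x) ∈ A := by
      refine hball ?_
      rw [mem_ball_zero_iff, norm_smul, norm_inv, Real.norm_of_nonneg h1.le,
        inv_mul_lt_iff₀ h1]
      rw [mem_ball_iff_norm] at hz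
      nlinarith [ht1 k hk]
    have := hA hz' hx h1.le (ht0 k) (by ring)
    rwa [smul_inv_smul₀ h1.ne', sub_add_cancel] at this
  have hdisj : (Finset.range N : Set ℕ).PairwiseDisjoint
      fun k => Metric.ball (t k • x) (δ / 2) := by
    intro k _ l _ hkl
    refine Metric.ball_disjoint_ball ?_
    have h1 : (1 : ℝ) ≤ |(k : ℝ) - l| := by
      have : (1 : ℤ) ≤ |(k : ℤ) - l| := Int.one_le_abs (sub_ne_zero.2 (by exact_mod_cast hkl))
      exact_mod_cast this
    rw [dist_eq_norm, ← sub_smul, norm_smul, Real.norm_eq_abs, ht]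
    have h2 : (k : ℝ) * δ / ‖x‖ - l * δ / ‖x‖ = (k - l) * (δ / ‖x‖) := by ring
    rw [h2, abs_mul, abs_of_pos (by positivity : 0 < δ / ‖x‖), mul_assoc,
      div_mul_cancel₀ _ hxn.ne']
    nlinarith
  have hmeas : (N : ℝ) * V.toReal ≤ C := by
    have h1 := measure_mono (μ := volume) hsub
    rw [measure_biUnion_finset hdisj fun k _ => measurableSet_ball] at h1
    simp only [Measure.addHaar_ball_center, Finset.sum_const, Finset.card_range,
      nsmul_eq_mul] at h1
    have h2 := ENNReal.toReal_mono hfin h1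
    rw [ENNReal.toReal_mul, ENNReal.toReal_natCast] at h2
    exact h2.trans hvol
  have hNx : ‖x‖ / (2 * δ) ≤ N := by
    rw [hN]
    push_cast
    exact (Nat.lt_floor_add_one _).le
  rw [div_le_iff₀ (by positivity)] at hNx
  have : (N : ℝ) ≤ C / V.toReal := (le_div_iff₀ hVpos).2 hmeas
  nlinarith

/-- The constant is fixed before the data. `D` bounds `A`, which contains the ball of radius `εR`
and has volume at most `C`; `N₁` comes from a maximum with `r < R` and `N₂` from one at `r = R`. -/
theorem exists_radialDeriv_le (hd : 2 ≤ d) {C Lam R ε : ℝ} (hC : 0 < C) (hR : 0 < R)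
    (hε : 0 < ε) :
    ∃ D₁ : ℝ, 0 < D₁ ∧ ∀ (A : Set (Euc d)) (φ ρ₀ ρ₁ : Euc d → ℝ), IsGaussTransport R A φ ρ₀ ρ₁ →
      (∀ x ∈ interior A, ‖gradient ρ₀ x‖ / ρ₀ x ≤ C) →
      (∀ x ∈ A, 1 / C ≤ ρ₀ x) →
      (∀ r ∈ Ioc 0 R, ∀ θ ∈ Metric.sphere (0 : Euc d) 1, polarDensity ρ₁ r θ ≤ C) →
      (∀ r ∈ Ioo 0 R, ∀ θ ∈ Metric.sphere (0 : Euc d) 1,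
        -C ≤ deriv (fun s => polarDensity ρ₁ s θ) r / polarDensity ρ₁ r θ) →
      HasC2Boundary A →
      (∀ x ∈ frontier A, gaussCurvature A x ≤ Lam) →
      (∀ r ∈ Ioc 0 R, ∀ θ ∈ Metric.sphere (0 : Euc d) 1, ε * r ≤ dualPotential A φ r θ) →
      ∀ r ∈ Ioc 0 R, ∀ θ ∈ Metric.sphere (0 : Euc d) 1,
        radialDeriv R (dualPotential A φ) r θ ≤ D₁ / r ^ d := by
  set D : ℝ := 2 * (ε * R) *
    (C / (volume (Metric.ball (0 : Euc d) (ε * R / 2))).toReal) with hDdef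
  have hD0 : 0 ≤ D := by positivity
  set K : ℝ := C * (D + ε * R) + d with hKdef
  have hK0 : 0 < K := by positivity
  set N₁ : ℝ := 2 * C ^ 2 * (2 * K / ε) ^ (d - 1) / ε with hN₁
  -- The maximum with `1` keeps the constant positive, since `Lam` has no prescribed sign.
  set N₂ : ℝ := R ^ d * (C * max Lam 1 * C / (ε * R / 2)) with hN₂
  have hN₁0 : 0 < N₁ := by positivity
  have hN₂0 : 0 < N₂ := by positivity
  refine ⟨(N₁ + N₂) * Real.exp ((C + 1) * R) * (D + 1), by positivity, ?_⟩
  intro A φ ρ₀ ρ₁ h hgrad hρ hP hP' hA hK hH r₀ hr₀ θ₀ hθ₀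
  have hRR : R ∈ Ioc 0 R := ⟨hR, le_rfl⟩
  have hD : ∀ x ∈ A, ‖x‖ ≤ D := by
    refine fun x hx => norm_le_of_volume_le h.data.convex h.data.isCompact.measure_lt_top.ne
      (mul_pos hε hR) (h.volume_le hC hρ) (fun y hy => ?_) hx
    refine (h.mem_of_forall_inner_le hR.le fun θ hθ => ?_).1
    rw [mem_ball_zero_iff] at hy
    refine le_trans ?_ (hH R hRR θ hθ)
    refine (real_inner_le_norm θ y).trans ?_
    rw [mem_sphere_zero_iff_norm.1 hθ, one_mul]
    exact hy.le
  set w : ℝ → ℝ := fun s => s ^ d * Real.exp ((C + 1) * s) with hw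
  have hden : ∀ s ∈ Ioc 0 R, ∀ η ∈ Metric.sphere (0 : Euc d) 1,
      ε * s / 2 ≤ dualPotential A φ s η - ε * s / 2 := fun s hs η hη => by
    linarith [hH s hs η hη]
  have hden0 : ∀ s ∈ Ioc 0 R, ∀ η ∈ Metric.sphere (0 : Euc d) 1,
      0 < dualPotential A φ s η - ε * s / 2 := fun s hs η hη =>
    (by have := hs.1; positivity : 0 < ε * s / 2).trans_le (hden s hs η hη)
  set Φ : ℝ × Euc d → ℝ := fun p => w p.1 * radialDeriv R (dualPotential A φ) p.1 p.2
    / (dualPotential A φ p.1 p.2 - ε * p.1 / 2) with hΦ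
  have hsub : Icc r₀ R ⊆ Ioc 0 R := fun s hs => ⟨hr₀.1.trans_le hs.1, hs.2⟩
  have hcont : ContinuousOn Φ (Icc r₀ R ×ˢ Metric.sphere 0 1) := by
    have hs := prod_mono hsub (Subset.refl (Metric.sphere (0 : Euc d) 1))
    refine ContinuousOn.div (ContinuousOn.mul (Continuous.continuousOn (by fun_prop))
      (h.smooth.c1_radialDeriv.continuousOn.mono hs))
      ((h.smooth.c1.continuousOn.mono hs).sub (Continuous.continuousOn (by fun_prop))) ?_
    exact fun p hp => (hden0 p.1 (hsub hp.1) p.2 hp.2).ne'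
  obtain ⟨⟨r, θ⟩, ⟨hr, hθ⟩, hmax⟩ := (isCompact_Icc.prod (isCompact_sphere (0 : Euc d)
    1)).exists_isMaxOn ⟨(r₀, θ₀), ⟨⟨le_rfl, hr₀.2⟩, hθ₀⟩⟩ hcont
  have hmax' : ∀ s ∈ Icc r₀ R, ∀ η ∈ Metric.sphere (0 : Euc d) 1, Φ (s, η) ≤ Φ (r, θ) :=
    fun s hs η hη => hmax (show (s, η) ∈ Icc r₀ R ×ˢ Metric.sphere 0 1 from ⟨hs, hη⟩)
  simp only at hr hθ
  have hr1 : r ∈ Ioc 0 R := hsub hr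
  have hbound : Φ (r, θ) ≤ (N₁ + N₂) * Real.exp ((C + 1) * R) := by
    obtain ⟨hp1, hp2, hp3⟩ := h.pos hd hr1 hθ
    rcases hr.2.eq_or_lt with hrR | hrR
    · obtain ⟨x, hxf, hxA, hx0, hKx, hpx⟩ := h.radialDeriv_boundary hd hR hA hθ
      have h1 : radialDeriv R (dualPotential A φ) R θ ≤ C * max Lam 1 * C := by
        rw [hpx, div_le_iff₀ hx0]
        have e1 := hρ x hxA
        rw [div_le_iff₀ hC] at e1
        calc polarDensity ρ₁ R θ * gaussCurvature A x ≤ C * max Lam 1 :=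
              mul_le_mul (hP R hRR θ hθ) ((hK x hxf).trans (le_max_left _ _)) hKx.le hC.le
          _ ≤ C * max Lam 1 * (ρ₀ x * C) := le_mul_of_one_le_right (by positivity) e1
          _ = _ := by ring
      have h2 : Φ (r, θ) ≤ N₂ * Real.exp ((C + 1) * R) := by
        simp only [hΦ, hw, hrR]
        rw [mul_div_assoc]
        calc R ^ d * Real.exp ((C + 1) * R) * (radialDeriv R (dualPotential A φ) R θ
              / (dualPotential A φ R θ - ε * R / 2))
            ≤ R ^ d * Real.exp ((C + 1) * R) * (C * max Lam 1 * C / (ε * R / 2)) := by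
              gcongr
              exact hden R hRR θ hθ
          _ = _ := by rw [hN₂]; ring
      refine h2.trans ?_
      gcongr
      linarith
    · have hr2 : r ∈ Ioo 0 R := ⟨hr1.1, hrR⟩
      have hwr : 0 < w r := mul_pos (pow_pos hr1.1 d) (Real.exp_pos _)
      have hdenr := hden0 r hr1 θ hθ
      set c := ε * r / 2 with hc
      have hc0 : 0 < c := by have := hr1.1; positivity
      set q := radialDeriv R (dualPotential A φ) r θ / (dualPotential A φ r θ - c) with hq
      have hΦq : Φ (r, θ) = w r * q := by 
        simp only [hΦ, hq, ← hc]
        rw [mul_div_assoc]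
      have heq : radialDeriv R (dualPotential A φ) r θ = q * (dualPotential A φ r θ - c) := by
        rw [hq, div_mul_cancel₀ _ hdenr.ne']
      have hmaxq : ∀ η ∈ Metric.sphere (0 : Euc d) 1,
          radialDeriv R (dualPotential A φ) r η ≤ q * (dualPotential A φ r η - c) := by
        intro η hη
        have := hmax' r hr η hη
        rw [hΦq] at this
        simp only [hΦ] at this
        rw [mul_div_assoc] at this
        exact (div_le_iff₀ (hden0 r hr1 η hη)).1 (le_of_mul_le_mul_left this hwr)
      have hq0 : 0 < q := div_pos hp2 hdenr
      have hrr : radialDeriv R (radialDeriv R (dualPotential A φ)) r θ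
          ≤ (q - (C + 1)) * radialDeriv R (dualPotential A φ) r θ := by
        -- The derivative of the weight is at least `(C + 1) w`. The remaining part, from `r^d`, and
        -- the term from the slope `ε / 2` have a favourable sign and are dropped.
        have hwd : HasDerivAt w (d * r ^ (d - 1) * Real.exp ((C + 1) * r) + (C + 1) * w r) r := by
          have := (hasDerivAt_pow d r).mul (((hasDerivAt_id r).const_mul (C + 1)).exp)
          refine this.congr_deriv ?_
          simp only [hw, id, mul_one]
          ring
        have hder := (hwd.mul (h.smooth.c1_radialDeriv.hasDerivAt hr2 hθ)).sub
          (((h.smooth.c1.hasDerivAt hr2 hθ).sub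
            (((hasDerivAt_id r).const_mul ε).div_const 2)).const_mul (w r * q))
        have := hasDerivAt_nonpos_of_forall_le hrR hder (fun s hs => by
          have hs' : s ∈ Icc r₀ R := ⟨hr.1.trans hs.1.le, hs.2.le⟩
          have e1 := hmax' s hs' θ hθ
          rw [hΦq] at e1
          simp only [hΦ] at e1
          rw [div_le_iff₀ (hden0 s (hsub hs') θ hθ)] at e1
          simp only [Pi.sub_apply, Pi.mul_apply, id, ← hc]
          have e2 : w r * radialDeriv R (dualPotential A φ) r θ
              - w r * q * (dualPotential A φ r θ - c) = 0 := by
            rw [heq]; ring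
          rw [e2]
          linarith)
        have e3 : 0 ≤ d * r ^ (d - 1) * Real.exp ((C + 1) * r)
            * radialDeriv R (dualPotential A φ) r θ := by
          have := hr1.1
          positivity
        have e4 : 0 ≤ w r * q * (ε / 2) := by positivity
        refine le_of_mul_le_mul_left ?_ hwr
        linarith
      have hmain := h.mul_rpow_le_of_tangency hd hr2 hθ hC hc0.le hq0 hmaxq heq hrr hgrad hρ
        (hP r hr1 θ hθ) (hP' r hr2 θ hθ) hD
      set n := d - 1 with hn
      have hdn : d = n + 1 := by omega
      have hn0 : n ≠ 0 := by omega
      have hcK : C * (D + c) + d ≤ K := by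
        have : c ≤ ε * R := by rw [hc]; nlinarith [hr1.1]
        rw [hKdef]
        gcongr
      have h1 : (radialDeriv R (dualPotential A φ) r θ / C ^ 2) ^ (1 / (n : ℝ)) ≤ K / c := by
        rw [le_div_iff₀ hc0, mul_comm]
        exact hmain.trans hcK
      have h2 : radialDeriv R (dualPotential A φ) r θ / C ^ 2 ≤ (K / c) ^ n := by
        have e1 := pow_le_pow_left₀ (by positivity) h1 n
        rwa [one_div, Real.rpow_inv_natCast_pow (by positivity) hn0] at e1
      rw [div_le_iff₀ (by positivity)] at h2
      have h3 : q ≤ (K / c) ^ n * C ^ 2 / c :=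
        div_le_div₀ (by positivity) h2 hc0 (hden r hr1 θ hθ)
      have h4 : Φ (r, θ) ≤ N₁ * Real.exp ((C + 1) * R) := by
        rw [hΦq]
        calc w r * q ≤ r ^ d * Real.exp ((C + 1) * R) * ((K / c) ^ n * C ^ 2 / c) := by
              have := hr1.1
              simp only [hw]
              gcongr
          _ = _ := by
              have hrne := hr1.1.ne'
              have e : (K / c) ^ n * r ^ n = (2 * K / ε) ^ n := by
                rw [← mul_pow, hc]
                congr 1
                field_simp
              rw [hN₁, ← e, hdn, pow_succ]
              generalize (K / c) ^ n = X
              rw [hc]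
              field_simp
      refine h4.trans ?_
      gcongr
      linarith
  have h1 := (hmax' r₀ ⟨le_rfl, hr₀.2⟩ θ₀ hθ₀).trans hbound
  simp only [hΦ, hw] at h1
  rw [div_le_iff₀ (hden0 r₀ hr₀ θ₀ hθ₀)] at h1
  have hHD : dualPotential A φ r₀ θ₀ - ε * r₀ / 2 ≤ D + 1 := by
    obtain ⟨y, hy, -, hyeq⟩ := h.exists_inner_eq hr₀.1.le θ₀
    have e1 := real_inner_le_norm θ₀ y
    rw [mem_sphere_zero_iff_norm.1 hθ₀, one_mul, hyeq] at e1
    have e2 := hD y hy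
    have := mul_pos hε hr₀.1
    linarith
  have hp2 := (h.pos hd hr₀ hθ₀).2.1
  have hrd : 0 < r₀ ^ d := pow_pos hr₀.1 d
  rw [le_div_iff₀ hrd]
  have hexp : 1 ≤ Real.exp ((C + 1) * r₀) := Real.one_le_exp (by have := hr₀.1; positivity)
  calc radialDeriv R (dualPotential A φ) r₀ θ₀ * r₀ ^ d
      ≤ r₀ ^ d * Real.exp ((C + 1) * r₀) * radialDeriv R (dualPotential A φ) r₀ θ₀ := by
        rw [mul_comm]
        gcongr
        exact le_mul_of_one_le_right hrd.le hexp
    _ ≤ _ := h1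
    _ ≤ _ := by gcongr

/-! ### Part (a): the lower bound by a minimum principle. -/

/-- A comparison principle for the minimum over a compact set of a family of functions of one
variable, whose derivative is bounded by an integrable function at the minimum points. -/
theorem sub_integral_le_of_deriv_le_at_min {X : Type*} [TopologicalSpace X] {S : Set X}
    (hS : IsCompact S) {ℓ k : ℝ → X → ℝ} {a b c : ℝ} {w : ℝ → ℝ} (hab : a ≤ b)
    (hder : ∀ r ∈ Icc a b, ∀ θ ∈ S, HasDerivWithinAt (fun s => ℓ s θ) (k r θ) (Icc a b) r)
    (hℓ : ∀ r ∈ Icc a b, ContinuousOn (ℓ r) S)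
    (hk : ContinuousOn (fun p : ℝ × X => k p.1 p.2) (Icc a b ×ˢ S))
    (hmin : ∀ r ∈ Ioo a b, ∀ θ ∈ S, (∀ η ∈ S, ℓ r θ ≤ ℓ r η) → k r θ ≤ w r)
    (hw : IntervalIntegrable w volume a b) (hb : ∀ θ ∈ S, c ≤ ℓ b θ) {θ₀ : X} (hθ₀ : θ₀ ∈ S) :
    c - ∫ s in a..b, w s ≤ ℓ a θ₀ := by
  obtain ⟨L, hL⟩ := (isCompact_Icc.prod hS).exists_bound_of_continuousOn hk
  have hL0 : 0 ≤ L := (norm_nonneg _).trans (hL (a, θ₀) ⟨left_mem_Icc.2 hab, hθ₀⟩)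
  have hlip : ∀ s ∈ Icc a b, ∀ t ∈ Icc a b, ∀ θ ∈ S, ℓ s θ ≤ ℓ t θ + L * |s - t| := by
    intro s hs t ht θ hθ
    have := (convex_Icc a b).norm_image_sub_le_of_norm_hasDerivWithin_le
      (fun r hr => hder r hr θ hθ) (fun r hr => hL (r, θ) ⟨hr, hθ⟩) ht hs
    have := (le_abs_self _).trans this
    rw [Real.norm_eq_abs] at this
    linarith
  have hex : ∀ r, ∃ θ, r ∈ Icc a b → θ ∈ S ∧ ∀ η ∈ S, ℓ r θ ≤ ℓ r η := by
    intro r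
    by_cases hr : r ∈ Icc a b
    · obtain ⟨θ, hθ, hθm⟩ := hS.exists_isMinOn ⟨θ₀, hθ₀⟩ (hℓ r hr)
      exact ⟨θ, fun _ => ⟨hθ, fun η hη => hθm hη⟩⟩
    · exact ⟨θ₀, fun h => absurd h hr⟩
  choose τ hτ using hex
  set m : ℝ → ℝ := fun r => ℓ r (τ r) with hm
  -- Lipschitz continuity makes the minimum absolutely continuous, so it is the integral of its
  -- derivative, which need only be bounded almost everywhere.
  have hmlip : LipschitzOnWith ⟨L, hL0⟩ m (uIcc a b) := by
    rw [uIcc_of_le hab]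
    refine LipschitzOnWith.of_le_add_mul _ fun s hs t ht => ?_
    refine ((hτ s hs).2 _ (hτ t ht).1).trans ?_
    exact hlip s hs t ht _ (hτ t ht).1
  have hac := hmlip.absolutelyContinuousOnInterval
  have hle : ∀ᵐ r, r ∈ Icc a b → deriv m r ≤ w r := by
    have hne : ∀ᵐ r : ℝ, r ≠ a ∧ r ≠ b :=
      (Measure.ae_ne volume a).and (Measure.ae_ne volume b)
    filter_upwards [hac.ae_differentiableAt, hne] with r hr hrne hrI
    have hrm : HasDerivAt m (deriv m r) r := (hr (by rwa [uIcc_of_le hab])).hasDerivAt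
    have hrI' : r ∈ Ioo a b := ⟨hrI.1.lt_of_ne' hrne.1, hrI.2.lt_of_ne hrne.2⟩
    have h1 : HasDerivAt (fun s => ℓ s (τ r)) (k r (τ r)) r :=
      (hder r hrI _ (hτ r hrI).1).hasDerivAt (Icc_mem_nhds hrI'.1 hrI'.2)
    -- With the minimizer frozen at `τ r`, the function lies above `m` and touches it at `r`, so the
    -- two derivatives agree there.
    have h2 : IsLocalMin (fun s => ℓ s (τ r) - m s) r := by
      filter_upwards [Icc_mem_nhds hrI'.1 hrI'.2] with s hs
      simp only [hm, sub_self]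
      linarith [(hτ s hs).2 _ (hτ r hrI).1]
    have h3 := h2.hasDerivAt_eq_zero (h1.sub hrm)
    have h4 := hmin r hrI' _ (hτ r hrI).1 (hτ r hrI).2
    linarith
  have hint : ∫ s in a..b, deriv m s ≤ ∫ s in a..b, w s := by
    refine intervalIntegral.integral_mono_ae_restrict hab hac.intervalIntegrable_deriv hw ?_
    exact (ae_restrict_iff' measurableSet_Icc).2 hle
  rw [hac.integral_deriv_eq_sub] at hint
  have h1 := hb _ (hτ b (right_mem_Icc.2 hab)).1
  have h2 := (hτ a (left_mem_Icc.2 hab)).2 _ hθ₀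
  simp only [hm] at hint
  linarith

/-- The elementary inequality that absorbs the gradient term. -/
theorem neg_pow_le_mul_sub {n : ℕ} (hn : 1 ≤ n) {C p ρ : ℝ} (hC : 0 < C) (hp : 0 < p)
    (hρ : 0 < ρ) :
    -C ^ (n + 2) ≤ p * (n * (ρ * p / C) ^ (1 / (n : ℝ)) - C * ρ ^ (1 / ((n + 1 : ℕ) : ℝ))) := by
  set t := (ρ * p / C) ^ (1 / (n : ℝ)) with ht
  set σ := ρ ^ (1 / ((n + 1 : ℕ) : ℝ)) with hσ
  have ht0 : 0 ≤ t := by positivity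
  have hσ0 : 0 < σ := by positivity
  have htn : t ^ n = ρ * p / C := by
    rw [ht, one_div, Real.rpow_inv_natCast_pow (by positivity) (by omega)]
  have hσn : σ ^ (n + 1) = ρ := by
    rw [hσ, one_div, Real.rpow_inv_natCast_pow hρ.le (by omega)]
  have hn' : (1 : ℝ) ≤ n := by exact_mod_cast hn
  have hCn : 0 < C ^ (n + 2) := by positivity
  -- Either the bracket is nonnegative, or `t ≤ C σ`. In the latter case the `n`-th power gives `σ p
  -- ≤ C ^ (n + 1)`, so the negative term is at most `C ^ (n + 2)`.
  rcases le_or_gt (C * σ) (n * t) with h | h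
  · nlinarith [mul_nonneg hp.le (sub_nonneg.2 h)]
  · have h1 : t ≤ C * σ := (le_mul_of_one_le_left ht0 hn').trans h.le
    have h2 := pow_le_pow_left₀ ht0 h1 n
    rw [htn, mul_pow, div_le_iff₀ hC, ← hσn, pow_succ] at h2
    have h3 : σ * p ≤ C ^ (n + 1) := by
      refine le_of_mul_le_mul_left ?_ (pow_pos hσ0 n)
      calc σ ^ n * (σ * p) = σ ^ n * σ * p := by ring
        _ ≤ _ := h2
        _ = _ := by ring
    have h4 : p * (C * σ) ≤ C ^ (n + 2) := by
      calc p * (C * σ) = C * (σ * p) := by ring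
        _ ≤ C * C ^ (n + 1) := by gcongr
        _ = _ := by ring
    have h5 : 0 ≤ p * (n * t) := by positivity
    linarith [mul_sub p (n * t) (C * σ)]

/-- At a spatial minimum of `H_r` one has `(T⁻¹)_r = H_r θ` and `D²H_r ≥ 0`. The trace term, bounded
below by AM-GM, then controls the gradient term. -/
theorem IsGaussTransport.radialDeriv_radialDeriv_div_le (h : IsGaussTransport R A φ ρ₀ ρ₁)
    (hd : 2 ≤ d) (hr : r ∈ Ioo 0 R) (hθ : θ ∈ Metric.sphere (0 : Euc d) 1) {C U : ℝ} (hC : 0 < C)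
    (hmin : ∀ η ∈ Metric.sphere (0 : Euc d) 1,
      radialDeriv R (dualPotential A φ) r θ ≤ radialDeriv R (dualPotential A φ) r η)
    (hgrad : ∀ x ∈ interior A, ‖gradient ρ₀ x‖ ≤ C * ρ₀ x ^ (1 + 1 / (d : ℝ)))
    (hP : polarDensity ρ₁ r θ ≤ C)
    (hP' : deriv (fun s => polarDensity ρ₁ s θ) r / polarDensity ρ₁ r θ ≤ U) :
    radialDeriv R (radialDeriv R (dualPotential A φ)) r θ / radialDeriv R (dualPotential A φ) r θ
      ≤ U + C ^ (d + 1) := by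
  have hr' := Ioo_subset_Ioc_self hr
  obtain ⟨b, μ, hμ, hdet, -, hlog⟩ := h.logDeriv_polarDensity hd hr hθ
  obtain ⟨hp1, hp2, hp3⟩ := h.pos hd hr' hθ
  have hsol := h.solves r hr' θ hθ
  have htan := fun v hv hθv => h.smooth.hasDerivAt_radialDeriv_greatCircle hr hθ (v := v) hv hθv
  have htan2 := fun v hv hθv =>
    h.smooth.hasDerivAt_inner_radialDeriv_sphGrad_greatCircle hr hθ (v := v) hv hθv
  have hlocmin : ∀ v ∈ Metric.sphere (0 : Euc d) 1, inner ℝ θ v = 0 →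
      IsLocalMin (fun t => radialDeriv R (dualPotential A φ) r (greatCircle θ v t)) 0 := by
    intro v hv hθv
    refine Eventually.of_forall fun t => ?_
    simpa using hmin _ (greatCircle_mem_sphere hθ hv hθv t)
  have hG : radialDeriv R (fun r => sphGrad (dualPotential A φ r)) r θ = 0 := by
    refine eq_of_inner_eq_of_forall_orthogonal (θ := θ) ?_ fun v hv hθv => ?_
    · rw [real_inner_comm, h.smooth.inner_radialDeriv_sphGrad_self hr hθ, inner_zero_right]
    · have := (hlocmin v hv hθv).hasDerivAt_eq_zero (htan v hv hθv 0)
      rw [real_inner_comm, inner_zero_right]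
      simpa using this
  have hB : ∀ i, 0 ≤ inner ℝ (radialDeriv R (fun r => sphHessExt (dualPotential A φ r)) r θ (b i))
      (b i : Euc d) := by
    intro i
    obtain ⟨hv, hθv⟩ := coe_mem_sphere_of_orthonormalBasis b i
    have := second_deriv_nonneg_of_isLocalMin (Eventually.of_forall (htan _ hv hθv))
      (htan2 _ hv hθv 0) (hlocmin _ hv hθv)
    simpa using this
  have hxint := h.inverseTransport_mem_interior hd hr hθ
  rw [hG, add_zero] at hlog
  set x := inverseTransport (dualPotential A φ) r θ with hxdef
  set p := radialDeriv R (dualPotential A φ) r θ with hpdef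
  have hdn : d - 1 + 1 = d := by omega
  have t1 : -(C * ρ₀ x ^ (1 / (d : ℝ)) * p) ≤ inner ℝ (gradient ρ₀ x) (p • θ) / ρ₀ x := by
    rw [le_div_iff₀ hp1]
    have e1 := (abs_le.1 (abs_real_inner_le_norm (gradient ρ₀ x) (p • θ))).1
    rw [norm_smul, mem_sphere_zero_iff_norm.1 hθ, mul_one, Real.norm_of_nonneg hp2.le] at e1
    have e2 := hgrad x hxint
    rw [Real.rpow_add hp1, Real.rpow_one] at e2
    nlinarith
  have t2 : p * ((d - 1 : ℕ) * (ρ₀ x * p / C) ^ (1 / ((d - 1 : ℕ) : ℝ))) ≤ ∑ i, (p + inner ℝ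
      (radialDeriv R (fun r => sphHessExt (dualPotential A φ r)) r θ (b i)) (b i : Euc d))
      / μ i := by
    have e1 : p * ∑ i, (μ i)⁻¹ ≤ ∑ i, (p + inner ℝ
      (radialDeriv R (fun r => sphHessExt (dualPotential A φ r)) r θ (b i)) (b i : Euc d))
      / μ i := by
      rw [Finset.mul_sum]
      refine Finset.sum_le_sum fun i _ => ?_
      rw [← div_eq_mul_inv]
      have := hμ i
      gcongr
      linarith [hB i]
    refine le_trans ?_ e1
    refine mul_le_mul_of_nonneg_left ?_ hp2.le
    refine le_trans ?_ (card_mul_inv_prod_rpow_le_sum_inv (by omega : 0 < d - 1) hμ)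
    gcongr
    rw [← hdet, ← one_div, div_le_div_iff₀ hC hp3, one_mul]
    rw [hsol] at hP
    exact hP
  have t3 := neg_pow_le_mul_sub (by omega : 1 ≤ d - 1) hC hp2 hp1
  rw [hdn, show d - 1 + 2 = d + 1 by omega] at t3
  rw [hlog] at hP'
  linarith [mul_sub p ((d - 1 : ℕ) * (ρ₀ x * p / C) ^ (1 / ((d - 1 : ℕ) : ℝ))) (C * ρ₀ x ^ (1 / (d : ℝ)))]

/-- The comparison principle is applied to `log H_r`, whose radial derivative is `H_rr / H_r`. The
factor `lam / C ^ 2` comes from `H_r = P K / ρ₀` at `r = R`, and the first exponential from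
integrating the error `C ^ (d + 1)` over a length at most `R`. -/
theorem IsGaussTransport.le_radialDeriv (h : IsGaussTransport R A φ ρ₀ ρ₁) (hd : 2 ≤ d)
    {C lam : ℝ} {u : ℝ → ℝ} (hC : 0 < C) (hlam : 0 < lam)
    (hgrad : ∀ x ∈ interior A, ‖gradient ρ₀ x‖ ≤ C * ρ₀ x ^ (1 + 1 / (d : ℝ)))
    (hP : ∀ r ∈ Ioc 0 R, ∀ θ ∈ Metric.sphere (0 : Euc d) 1, polarDensity ρ₁ r θ ≤ C)
    (hu : ∀ a ∈ Ioo 0 R, IntegrableOn u (Icc a R))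
    (hP' : ∀ r ∈ Ioo 0 R, ∀ θ ∈ Metric.sphere (0 : Euc d) 1,
      deriv (fun s => polarDensity ρ₁ s θ) r / polarDensity ρ₁ r θ ≤ u r)
    (hA : HasC2Boundary A) (hK : ∀ x ∈ frontier A, lam ≤ gaussCurvature A x)
    (hρ : ∀ x ∈ frontier A, ρ₀ x ≤ C)
    (hPR : ∀ θ ∈ Metric.sphere (0 : Euc d) 1, 1 / C ≤ polarDensity ρ₁ R θ)
    (hr : r ∈ Ioc 0 R) (hθ : θ ∈ Metric.sphere (0 : Euc d) 1) :
    lam / C ^ 2 * Real.exp (-(C ^ (d + 1) * R)) * Real.exp (-∫ s in r..R, u s)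
      ≤ radialDeriv R (dualPotential A φ) r θ := by
  have hR : 0 < R := hr.1.trans_le hr.2
  have hbd : ∀ θ ∈ Metric.sphere (0 : Euc d) 1,
      Real.log (lam / C ^ 2) ≤ Real.log (radialDeriv R (dualPotential A φ) R θ) := by
    intro θ hθ
    refine Real.log_le_log (by positivity) ?_
    obtain ⟨x, hxf, hxA, hx0, hKx, hpx⟩ := h.radialDeriv_boundary hd hR hA hθ
    rw [hpx]
    calc lam / C ^ 2 = 1 / C * lam / C := by field_simp
      _ ≤ _ := by
        have e1 := hPR θ hθ
        have e2 := hK x hxf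
        have e3 := hρ x hxf
        have e4 := h.polarDensity_pos ⟨hR, le_rfl⟩ hθ
        exact div_le_div₀ (by positivity) (mul_le_mul e1 e2 hlam.le e4.le) hx0 e3
  have hsub : Icc r R ⊆ Ioc 0 R := fun s hs => ⟨hr.1.trans_le hs.1, hs.2⟩
  have hprod := prod_mono hsub (Subset.refl (Metric.sphere (0 : Euc d) 1))
  have huI : IntervalIntegrable u volume r R := by
    rcases hr.2.eq_or_lt with hrR | hrR
    · rw [hrR]
    · exact (intervalIntegrable_iff_integrableOn_Icc_of_le hr.2).2 (hu r ⟨hr.1, hrR⟩)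
  have key := sub_integral_le_of_deriv_le_at_min (isCompact_sphere (0 : Euc d) 1)
    (ℓ := fun s θ => Real.log (radialDeriv R (dualPotential A φ) s θ))
    (k := fun s θ => radialDeriv R (radialDeriv R (dualPotential A φ)) s θ
      / radialDeriv R (dualPotential A φ) s θ)
    (w := fun s => u s + C ^ (d + 1)) hr.2
    (fun s hs η hη => ((h.smooth.c1_radialDeriv.hasDerivWithinAt (hsub hs) hη).mono hsub).log
      (h.pos hd (hsub hs) hη).2.1.ne')
    (fun s hs => ContinuousOn.log (h.smooth.c1_radialDeriv.continuousOn.comp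
      (f := fun η => (s, η)) (by fun_prop) fun η hη => ⟨hsub hs, hη⟩)
      fun η hη => (h.pos hd (hsub hs) hη).2.1.ne')
    (ContinuousOn.div (h.smooth.c1_radialDeriv.continuousOn_radialDeriv.mono hprod)
      (h.smooth.c1_radialDeriv.continuousOn.mono hprod)
      fun p hp => (h.pos hd (hsub hp.1) hp.2).2.1.ne')
    (fun s hs η hη hmin => by
      have hs' : s ∈ Ioo 0 R := ⟨hr.1.trans hs.1, hs.2⟩
      refine h.radialDeriv_radialDeriv_div_le hd hs' hη hC (fun η' hη' => ?_) hgrad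
        (hP s (Ioo_subset_Ioc_self hs') η hη) (hP' s hs' η hη)
      exact (Real.log_le_log_iff (h.pos hd (Ioo_subset_Ioc_self hs') hη).2.1
        (h.pos hd (Ioo_subset_Ioc_self hs') hη').2.1).1 (hmin η' hη'))
    (huI.add intervalIntegrable_const) hbd hθ
  rw [intervalIntegral.integral_add huI intervalIntegrable_const,
    intervalIntegral.integral_const, smul_eq_mul] at key
  have hp := (h.pos hd hr hθ).2.1
  rw [← Real.exp_log hp]
  calc lam / C ^ 2 * Real.exp (-(C ^ (d + 1) * R)) * Real.exp (-∫ s in r..R, u s)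
      = Real.exp (Real.log (lam / C ^ 2) + -(C ^ (d + 1) * R) + -∫ s in r..R, u s) := by
        rw [Real.exp_add, Real.exp_add, Real.exp_log (by positivity)]
    _ ≤ _ := by
        refine Real.exp_le_exp.2 (le_trans ?_ key)
        have : (R - r) * C ^ (d + 1) ≤ C ^ (d + 1) * R := by
          have : 0 < C ^ (d + 1) := by positivity
          nlinarith [hr.1]
        linarith

end GaussTransport

/-! ### The two estimates, with gradient bounds from `|∇φ| = 1 / H_r`. -/

theorem mainTheorem7 (d : ℕ) (hd : 2 ≤ d) :
    (∀ C lam R : ℝ, 0 < C → 0 < lam → 0 < R →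
      ∃ D₁ D₂ : ℝ, 0 < D₁ ∧ 0 < D₂ ∧
        ∀ (A : Set (EuclideanSpace ℝ (Fin d))) (φ ρ₀ ρ₁ : EuclideanSpace ℝ (Fin d) → ℝ)
          (u : ℝ → ℝ),
          GaussTransport.IsGaussData R A φ ρ₀ ρ₁ →
          GaussTransport.IsSmoothPotential R (GaussTransport.dualPotential A φ) →
          GaussTransport.SolvesChangeOfVariables R (GaussTransport.dualPotential A φ) ρ₀ ρ₁ →
          (∀ x ∈ interior A, ‖gradient ρ₀ x‖ ≤ C * ρ₀ x ^ (1 + 1 / (d : ℝ))) →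
          (∀ r ∈ Ioc 0 R, ∀ θ ∈ Metric.sphere (0 : EuclideanSpace ℝ (Fin d)) 1,
            GaussTransport.polarDensity ρ₁ r θ ≤ C) →
          (∀ a ∈ Ioo 0 R, IntegrableOn u (Icc a R)) →
          (∀ r ∈ Ioo 0 R, ∀ θ ∈ Metric.sphere (0 : EuclideanSpace ℝ (Fin d)) 1,
            deriv (fun s => GaussTransport.polarDensity ρ₁ s θ) r
              / GaussTransport.polarDensity ρ₁ r θ ≤ u r) →
          GaussTransport.HasC2Boundary A →
          (∀ x ∈ frontier A, lam ≤ GaussTransport.gaussCurvature A x) →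
          (∀ x ∈ frontier A, ρ₀ x ≤ C) →
          (∀ θ ∈ Metric.sphere (0 : EuclideanSpace ℝ (Fin d)) 1,
            1 / C ≤ GaussTransport.polarDensity ρ₁ R θ) →
          (∀ r ∈ Ioc 0 R, ∀ θ ∈ Metric.sphere (0 : EuclideanSpace ℝ (Fin d)) 1,
            D₁ * Real.exp (-∫ s in r..R, u s) ≤
              GaussTransport.radialDeriv R (GaussTransport.dualPotential A φ) r θ) ∧
          (∀ x ∈ A, 0 < φ x →
            DifferentiableWithinAt ℝ φ A x ∧
              ‖gradientWithin φ A x‖ ≤ D₂ * Real.exp (∫ s in (φ x)..R, u s))) ∧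
    (∀ C Lam R ε : ℝ, 0 < C → 0 < R → 0 < ε →
      ∃ D₁ D₂ : ℝ, 0 < D₁ ∧ 0 < D₂ ∧
        ∀ (A : Set (EuclideanSpace ℝ (Fin d))) (φ ρ₀ ρ₁ : EuclideanSpace ℝ (Fin d) → ℝ),
          GaussTransport.IsGaussData R A φ ρ₀ ρ₁ →
          GaussTransport.IsSmoothPotential R (GaussTransport.dualPotential A φ) →
          GaussTransport.SolvesChangeOfVariables R (GaussTransport.dualPotential A φ) ρ₀ ρ₁ →
          (∀ x ∈ interior A, ‖gradient ρ₀ x‖ / ρ₀ x ≤ C) →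
          (∀ x ∈ A, 1 / C ≤ ρ₀ x) →
          (∀ r ∈ Ioc 0 R, ∀ θ ∈ Metric.sphere (0 : EuclideanSpace ℝ (Fin d)) 1,
            GaussTransport.polarDensity ρ₁ r θ ≤ C) →
          (∀ r ∈ Ioo 0 R, ∀ θ ∈ Metric.sphere (0 : EuclideanSpace ℝ (Fin d)) 1,
            -C ≤ deriv (fun s => GaussTransport.polarDensity ρ₁ s θ) r
              / GaussTransport.polarDensity ρ₁ r θ) →
          GaussTransport.HasC2Boundary A →
          (∀ x ∈ frontier A, GaussTransport.gaussCurvature A x ≤ Lam) →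
          (∀ r ∈ Ioc 0 R, ∀ θ ∈ Metric.sphere (0 : EuclideanSpace ℝ (Fin d)) 1,
            ε * r ≤ GaussTransport.dualPotential A φ r θ) →
          (∀ r ∈ Ioc 0 R, ∀ θ ∈ Metric.sphere (0 : EuclideanSpace ℝ (Fin d)) 1,
            GaussTransport.radialDeriv R (GaussTransport.dualPotential A φ) r θ ≤ D₁ / r ^ d) ∧
          (∀ x ∈ A, 0 < φ x →
            DifferentiableWithinAt ℝ φ A x ∧
              D₂ * φ x ^ d ≤ ‖gradientWithin φ A x‖)) := by
  refine ⟨fun C lam R hC hlam hR => ?_, fun C Lam R ε hC hR hε => ?_⟩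
  · set D : ℝ := lam / C ^ 2 * Real.exp (-(C ^ (d + 1) * R)) with hD
    have hD0 : 0 < D := by positivity
    refine ⟨D, D⁻¹, hD0, inv_pos.2 hD0, ?_⟩
    intro A φ ρ₀ ρ₁ u hdata hsmooth hsolves hgrad hP hu hP' hA hK hρ hPR
    have h : GaussTransport.IsGaussTransport R A φ ρ₀ ρ₁ := ⟨hdata, hsmooth, hsolves⟩
    have hmain : ∀ r ∈ Ioc 0 R, ∀ θ ∈ Metric.sphere (0 : EuclideanSpace ℝ (Fin d)) 1,
        D * Real.exp (-∫ s in r..R, u s) ≤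
          GaussTransport.radialDeriv R (GaussTransport.dualPotential A φ) r θ := fun r hr θ hθ =>
      h.le_radialDeriv hd hC hlam hgrad hP hu hP' hA hK hρ hPR hr hθ
    refine ⟨hmain, fun x hx hx0 => ?_⟩
    obtain ⟨hdiff, θ, hθ, hnorm⟩ := h.exists_norm_gradientWithin_eq hd hx hx0
    refine ⟨hdiff, ?_⟩
    have h1 := hmain (φ x) ⟨hx0, (hdata.mapsTo hx).2⟩ θ hθ
    rw [hnorm]
    calc _ ≤ (D * Real.exp (-∫ s in (φ x)..R, u s))⁻¹ := inv_anti₀ (by positivity) h1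
      _ = _ := by rw [mul_inv, Real.exp_neg, inv_inv]
  · obtain ⟨D, hD0, hD⟩ := GaussTransport.exists_radialDeriv_le hd (Lam := Lam) hC hR hε
    refine ⟨D, D⁻¹, hD0, inv_pos.2 hD0, ?_⟩
    intro A φ ρ₀ ρ₁ hdata hsmooth hsolves hgrad hρ hP hP' hA hK hH
    have h : GaussTransport.IsGaussTransport R A φ ρ₀ ρ₁ := ⟨hdata, hsmooth, hsolves⟩
    have hmain := hD A φ ρ₀ ρ₁ h hgrad hρ hP hP' hA hK hH
    refine ⟨hmain, fun x hx hx0 => ?_⟩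
    have hxr : φ x ∈ Ioc 0 R := ⟨hx0, (hdata.mapsTo hx).2⟩
    obtain ⟨hdiff, θ, hθ, hnorm⟩ := h.exists_norm_gradientWithin_eq hd hx hx0
    refine ⟨hdiff, ?_⟩
    have h1 := hmain (φ x) hxr θ hθ
    rw [hnorm]
    calc D⁻¹ * φ x ^ d = (D / φ x ^ d)⁻¹ := by rw [inv_div, div_eq_mul_inv, mul_comm]
      _ ≤ _ := inv_anti₀ (h.pos hd hxr hθ).2.1 h1
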